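/- Let $\mathbb F$ be a field of characteristic zero and let $\mathcal L$ be the Schrödinger–Virasoro Lie algebra over $\mathbb F$, with basis $\{L_n, Y_p, M_n : n\in\mathbb Z,\ p\in\tfrac12+\mathbb Z\}$ and non-vanishing brackets $$[L_m,L_n]=(n-m)L_{m+n},\quad [L_m,M_n]=nM_{m+n},\quad [L_n,Y_p]=(p-\tfrac n2)Y_{n+p},\quad [Y_p,Y_q]=(q-p)M_{p+q}.$$ Let $U(\mathcal L)$ be its universal enveloping algebra with its standard Hopf algebra structure $(m,\iota,\Delta_0,S_0,\epsilon)$ (elements of $\mathcal L$ are primitive), extended coefficientwise to $U(\mathcal L)[[t]]$. Hopf structures on $U(\mathcal L)[[t]]$ over $\mathbb F[[t]]$ are understood in the topological sense: the tensor square of $U(\mathcal L)[[t]]$ is the completed one, $(U(\mathcal L)\otimes U(\mathcal L))[[t]]$. For an element $x$ of a unital $\mathbb F$-algebra, $a\in\mathbb F$ and $r\ge 0$ put $$x^{(r)}_a=(x+a)(x+a+1)\cdots(x+a+r-1),\qquad x^{[r]}_a=(x+a)(x+a-1)\cdots(x+a-r+1),$$ $x^{(r)}=x^{(r)}_0$,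 $x^{[r]}=x^{[r]}_0$, and $(1-xt)^a=\sum_{r\ge0}(-1)^r\binom ar x^rt^r$ with $\binom ar=a(a-1)\cdots(a-r+1)/r!$. Fix an odd integer $n_0$ and put $h=\frac{2}{n_0}L_0$, $e=Y_{n_0/2}$. Then $[h,e]=e$ in $\mathcal L$; the element $$\mathscr F=\sum_{r\ge0}\frac{(-1)^r}{r!}\,h^{[r]}\otimes e^r t^r\in (U(\mathcal L)\otimes U(\mathcal L))[[t]]$$ is a Drinfel'd twist, that is, it is invertible, $(\mathscr F\otimes1)(\Delta_0\otimes\mathrm{Id})(\mathscr F)=(1\otimes\mathscr F)(\mathrm{Id}\otimes\Delta_0)(\mathscr F)$ and $(\epsilon\otimes\mathrm{Id})(\mathscr F)=1=(\mathrm{Id}\otimes\epsilon)(\mathscr F)$; and there is a noncommutative and noncocommutative Hopf algebra structure $(U(\mathcal L)[[t]],m,\iota,\Delta,S,\epsilon)$ over $\mathbb F[[t]]$, with the undeformed product, unit and counit, which is the twisting by $\mathscr F$ of the standard one (that is, $\Delta(x)=\mathscr F\Delta_0(x)\mathscr F^{-1}$ and $S(x)=wS_0(x)w^{-1}$, where $w=m(\mathrm{Id}\otimes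 S_0)(\mathscr F)$ is invertible). Reduction modulo $t$ induces an algebra isomorphism $U(\mathcal L)[[t]]/tU(\mathcal L)[[t]]\cong U(\mathcal L)$, under which the coproduct, counit and antipode reduce to the standard ones of $U(\mathcal L)$. For all $n,k\in\mathbb Z$ and $p\in\frac12+\mathbb Z$, $$\Delta(L_n)=1\otimes L_n+L_n\otimes(1-et)^{\frac{2n}{n_0}}+\tfrac{n_0-n}{2}\,h\otimes(1-et)^{-1}Y_{n+\frac{n_0}2}t+\tfrac{n(n-n_0)}{4}\,h^{(2)}\otimes(1-et)^{-2}M_{n+n_0}t^2,$$ $$\Delta(M_k)=1\otimes M_k+M_k\otimes(1-et)^{\frac{2k}{n_0}},$$ $$\Delta(Y_p)=1\otimes Y_p+Y_p\otimes(1-et)^{\frac{2p}{n_0}}-(p-\tfrac{n_0}2)\,h\otimes(1-et)^{-1}M_{p+\frac{n_0}2}t,$$ $$S(L_n)=-(1-et)^{-\frac{2n}{n_0}}\Big(L_n+\tfrac{n-n_0}{2}Y_{n+\frac{n_0}2}h^{[1]}_1t+\tfrac{n(n-n_0)}{4}M_{n+n_0}h^{[2]}_2t^2\Big),$$ $$S(Y_p)=-(1-et)^{-\frac{2p}{n_0}}\Big(Y_p+(p-\tfrac{n_0}2)M_{p+\frac{n_0}2}h^{[1]}_1t\Big),\qquad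 S(M_k)=-(1-et)^{-\frac{2k}{n_0}}M_k.$$ -/

import Mathlib

open scoped PowerSeries TensorProduct

noncomputable section

/-! ### The Schrödinger–Virasoro Lie algebra -/

/-- The index set of the basis of the Schrödinger–Virasoro Lie algebra: `L n` and `M n` stand for
`Lₙ` and `Mₙ` with `n ∈ ℤ`, and `Y j` stands for `Y_p` with `p = j + 1/2 ∈ 1/2 + ℤ`. -/
inductive SVIndex : Type
  | L (n : ℤ)
  | Y (j : ℤ)
  | M (n : ℤ)

/-- The underlying vector space of the Schrödinger–Virasoro Lie algebra over `F`. -/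
def SchrodingerVirasoro (F : Type*) [Field F] : Type _ := SVIndex →₀ F

namespace SchrodingerVirasoro

section
variable (F : Type*) [Field F]

instance : AddCommGroup (SchrodingerVirasoro F) := inferInstanceAs (AddCommGroup (SVIndex →₀ F))

instance : Module F (SchrodingerVirasoro F) := inferInstanceAs (Module F (SVIndex →₀ F))

/-- The basis `{Lₙ, Y_p, Mₙ}`. -/
def basis : Module.Basis SVIndex F (SchrodingerVirasoro F) := Finsupp.basisSingleOne

/-- The basis vector `Lₙ`. -/
def L (n : ℤ) : SchrodingerVirasoro F := basis F (.L n)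

/-- The basis vector `Y_{j + 1/2}`. -/
def Y (j : ℤ) : SchrodingerVirasoro F := basis F (.Y j)

/-- The basis vector `Mₙ`. -/
def M (n : ℤ) : SchrodingerVirasoro F := basis F (.M n)

/-- The brackets of the basis vectors:
`[Lₘ, Lₙ] = (n - m) Lₘ₊ₙ`, `[Lₘ, Mₙ] = n Mₘ₊ₙ`, `[Lₙ, Y_p] = (p - n/2) Y_{p+n}`,
`[Y_p, Y_q] = (q - p) M_{p+q}`, all the others being zero. -/
def basisBracket : SVIndex → SVIndex → SchrodingerVirasoro F
  | .L m, .L n => ((n : F) - m) • L F (m + n)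
  | .L m, .M n => (n : F) • M F (m + n)
  | .M n, .L m => -((n : F) • M F (m + n))
  | .L m, .Y j => ((j : F) + 1 / 2 - m / 2) • Y F (m + j)
  | .Y j, .L m => -(((j : F) + 1 / 2 - m / 2) • Y F (m + j))
  | .Y i, .Y j => (((j : F) + 1 / 2) - ((i : F) + 1 / 2)) • M F (i + j + 1)
  | .Y _, .M _ => 0
  | .M _, .Y _ => 0
  | .M _, .M _ => 0

/-- The bilinear extension of the bracket of the basis vectors. -/
def bracket : SchrodingerVirasoro F →ₗ[F] SchrodingerVirasoro F →ₗ[F] SchrodingerVirasoro F :=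
  (basis F).constr F fun i => (basis F).constr F fun j => basisBracket F i j

theorem bracket_basis (i j : SVIndex) :
    bracket F (basis F i) (basis F j) = basisBracket F i j := by
  simp [bracket, Module.Basis.constr_basis]

theorem bracket_skew (x y : SchrodingerVirasoro F) : bracket F x y = -bracket F y x := by
  have h : bracket F = -(bracket F).flip := by
    refine (basis F).ext fun i => (basis F).ext fun j => ?_
    simp only [LinearMap.neg_apply, LinearMap.flip_apply, bracket_basis]
    rcases i with i | i | i <;> rcases j with j | j | j <;>
      simp only [basisBracket, neg_neg, neg_zero]
    · rw [← neg_smul, neg_sub, add_comm j i]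
    · rw [← neg_smul, neg_sub, add_comm j i]
  exact congrArg (fun f => f x y) h

theorem bracket_jacobi [CharZero F] (x y z : SchrodingerVirasoro F) :
    bracket F x (bracket F y z) = bracket F (bracket F x y) z + bracket F y (bracket F x z) := by
  have key : ∀ i j k, bracket F (basis F i) (bracket F (basis F j) (basis F k)) =
      bracket F (bracket F (basis F i) (basis F j)) (basis F k) +
        bracket F (basis F j) (bracket F (basis F i) (basis F k)) := by
    intro i j k
    simp only [bracket_basis]
    cases i <;> cases j <;> cases k <;>
      simp only [basisBracket, L, M, Y, map_smul, map_neg, map_zero, LinearMap.smul_apply,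
        LinearMap.neg_apply, LinearMap.zero_apply, bracket_basis, smul_zero, neg_zero, add_zero]
    all_goals
      push_cast
      simp only [add_comm, add_left_comm, add_assoc, smul_neg, neg_neg]
      try module
  have hz : ∀ i j z, bracket F (basis F i) (bracket F (basis F j) z) =
      bracket F (bracket F (basis F i) (basis F j)) z +
        bracket F (basis F j) (bracket F (basis F i) z) := fun i j z =>
    congrArg (fun f => f z) ((basis F).ext (f₁ := bracket F (basis F i) ∘ₗ bracket F (basis F j))
      (f₂ := bracket F (bracket F (basis F i) (basis F j)) +
        bracket F (basis F j) ∘ₗ bracket F (basis F i)) fun k => key i j k)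
  have hy : ∀ i y z, bracket F (basis F i) (bracket F y z) =
      bracket F (bracket F (basis F i) y) z + bracket F y (bracket F (basis F i) z) :=
    fun i y z =>
    congrArg (fun f => f y) ((basis F).ext
      (f₁ := bracket F (basis F i) ∘ₗ (bracket F).flip z)
      (f₂ := (bracket F).flip z ∘ₗ bracket F (basis F i) +
        (bracket F).flip (bracket F (basis F i) z)) fun j => hz i j z)
  exact congrArg (fun f => f x) ((basis F).ext
      (f₁ := (bracket F).flip (bracket F y z))
      (f₂ := (bracket F).flip z ∘ₗ (bracket F).flip y +
        bracket F y ∘ₗ (bracket F).flip z) fun i => hy i y z)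

instance [CharZero F] : LieRing (SchrodingerVirasoro F) where
  bracket x y := bracket F x y
  add_lie x y z := by simp
  lie_add x y z := by simp
  lie_self x := by
    have h : (2 : F) • bracket F x x = 0 := by
      rw [two_smul]
      nth_rewrite 1 [bracket_skew]
      exact neg_add_cancel _
    exact (smul_eq_zero.mp h).resolve_left two_ne_zero
  leibniz_lie x y z := bracket_jacobi F x y z

instance [CharZero F] : LieAlgebra F (SchrodingerVirasoro F) where
  lie_smul c x y := (bracket F x).map_smul c y

end

end SchrodingerVirasoro

/-! ### The standard Hopf algebra structure of a universal enveloping algebra -/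

namespace UniversalEnvelopingAlgebra

section
variable (k : Type*) [CommRing k] {L : Type*} [LieRing L] [LieAlgebra k L]

attribute [local instance 100] LieRing.ofAssociativeRing

/-- The coproduct `Δ₀`, with `Δ₀(x) = x ⊗ 1 + 1 ⊗ x` for `x ∈ L`. -/
def comul₀ : UniversalEnvelopingAlgebra k L →ₐ[k]
    UniversalEnvelopingAlgebra k L ⊗[k] UniversalEnvelopingAlgebra k L :=
  lift k
    { toFun := fun x => ι k x ⊗ₜ[k] 1 + 1 ⊗ₜ[k] ι k x
      map_add' := fun x y => by
        simp only [map_add, TensorProduct.add_tmul, TensorProduct.tmul_add]; abel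
      map_smul' := fun c x => by
        simp only [map_smul, TensorProduct.smul_tmul', TensorProduct.tmul_smul, smul_add,
          RingHom.id_apply]
      map_lie' := fun {x y} => by
        simp only [LieHom.map_lie, LieRing.of_associative_ring_bracket, mul_add, add_mul,
          Algebra.TensorProduct.tmul_mul_tmul, one_mul, mul_one, TensorProduct.sub_tmul,
          TensorProduct.tmul_sub]
        abel }

/-- The counit `ε`, with `ε(x) = 0` for `x ∈ L`. -/
def counit₀ : UniversalEnvelopingAlgebra k L →ₐ[k] k := lift k 0

/-- The antipode `S₀`, with `S₀(x) = -x` for `x ∈ L`, as a homomorphism to the opposite algebra. -/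
def antipode₀ : UniversalEnvelopingAlgebra k L →ₐ[k] (UniversalEnvelopingAlgebra k L)ᵐᵒᵖ :=
  lift k
    { toFun := fun x => MulOpposite.op (-ι k x)
      map_add' := fun x y => by simp [add_comm]
      map_smul' := fun c x => by simp
      map_lie' := fun {x y} => by
        apply MulOpposite.unop_injective
        simp [LieRing.of_associative_ring_bracket] }

theorem comul₀_ι (x : L) : comul₀ k (ι k x) = ι k x ⊗ₜ[k] 1 + 1 ⊗ₜ[k] ι k x := by
  rw [comul₀, lift_ι_apply]; rfl

theorem counit₀_ι (x : L) : counit₀ k (ι k x) = 0 := by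
  rw [counit₀, lift_ι_apply]; rfl

theorem antipode₀_ι (x : L) : antipode₀ k (ι k x) = MulOpposite.op (-ι k x) := by
  rw [antipode₀, lift_ι_apply]; rfl

theorem ext_ι {A : Type*} [Ring A] [Algebra k A] {f g : UniversalEnvelopingAlgebra k L →ₐ[k] A}
    (h : ∀ x : L, f (ι k x) = g (ι k x)) : f = g :=
  hom_ext k (LieHom.ext h)

instance : Bialgebra k (UniversalEnvelopingAlgebra k L) :=
  Bialgebra.ofAlgHom (comul₀ k) (counit₀ k)
    (ext_ι k fun x => by
      simp [-ι_apply, comul₀_ι, TensorProduct.add_tmul, TensorProduct.tmul_add, add_assoc,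
        Algebra.TensorProduct.one_def])
    (ext_ι k fun x => by
      simp [-ι_apply, comul₀_ι, counit₀_ι])
    (ext_ι k fun x => by
      simp [-ι_apply, comul₀_ι, counit₀_ι])

/-- Induction principle: a property stable under the algebra operations and true on `L` holds. -/
theorem induction_U {P : UniversalEnvelopingAlgebra k L → Prop}
    (scalar : ∀ c, P (algebraMap k _ c)) (of : ∀ x : L, P (ι k x))
    (add : ∀ a b, P a → P b → P (a + b)) (mul : ∀ a b, P a → P b → P (a * b))
    (a : UniversalEnvelopingAlgebra k L) : P a := by
  let s : Subalgebra k (UniversalEnvelopingAlgebra k L) :=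
    { carrier := {a | P a}
      mul_mem' := fun {a b} => mul a b
      add_mem' := fun {a b} => add a b
      algebraMap_mem' := scalar }
  let f : L →ₗ⁅k⁆ s :=
    { toFun := fun x => ⟨ι k x, of x⟩
      map_add' := fun x y => Subtype.ext (map_add _ _ _)
      map_smul' := fun c x => Subtype.ext (map_smul _ _ _)
      map_lie' := fun {x y} => Subtype.ext (by
        simp [LieRing.of_associative_ring_bracket]) }
  have h : s.val.comp (lift k f) = AlgHom.id k _ := by
    apply hom_ext
    refine LieHom.ext fun x => ?_
    change s.val (lift k f (ι k x)) = ι k x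
    rw [lift_ι_apply]; rfl
  have := congrArg (fun g => g a) h
  change ((lift k f a : s) : UniversalEnvelopingAlgebra k L) = a at this
  rw [← this]
  exact (lift k f a).2

/-- The antipode `S₀` as a linear endomorphism. -/
def antipodeLin : UniversalEnvelopingAlgebra k L →ₗ[k] UniversalEnvelopingAlgebra k L :=
  (MulOpposite.opLinearEquiv k).symm.toLinearMap ∘ₗ (antipode₀ k).toLinearMap

theorem antipodeLin_one : antipodeLin k (1 : UniversalEnvelopingAlgebra k L) = 1 := by
  simp [antipodeLin]

theorem antipodeLin_ι (x : L) : antipodeLin k (ι k x) = -ι k x := by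
  simp [-ι_apply, antipodeLin, antipode₀_ι]

theorem antipodeLin_mul (a b : UniversalEnvelopingAlgebra k L) :
    antipodeLin k (a * b) = antipodeLin k b * antipodeLin k a := by
  simp [antipodeLin]

theorem antipode_left_aux (a : UniversalEnvelopingAlgebra k L) :
    ∀ T, LinearMap.mul' k _ ((antipodeLin k).rTensor _ (comul₀ k a * T)) =
      counit₀ k a • LinearMap.mul' k _ ((antipodeLin k).rTensor _ T) := by
  induction a using induction_U with
  | scalar c =>
    intro T
    rw [AlgHom.commutes, AlgHom.commutes, ← Algebra.smul_def, map_smul, map_smul]; rfl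
  | of x =>
    intro T
    induction T with
    | zero => simp
    | add y z hy hz => rw [mul_add, map_add, map_add, hy, hz, map_add, map_add, smul_add]
    | tmul y z =>
      simp [-ι_apply, comul₀_ι, counit₀_ι, add_mul, antipodeLin_mul, antipodeLin_ι, mul_assoc]
  | add a b ha hb =>
    intro T
    rw [map_add, add_mul, map_add, map_add, ha, hb, map_add, add_smul]
  | mul a b ha hb =>
    intro T
    rw [map_mul (comul₀ k), mul_assoc, ha, hb, map_mul, mul_smul]

theorem antipode_right_aux (a : UniversalEnvelopingAlgebra k L) :
    ∀ T, LinearMap.mul' k _ ((antipodeLin k).lTensor _ (T * comul₀ k a)) =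
      counit₀ k a • LinearMap.mul' k _ ((antipodeLin k).lTensor _ T) := by
  induction a using induction_U with
  | scalar c =>
    intro T
    rw [AlgHom.commutes, AlgHom.commutes, ← Algebra.commutes, ← Algebra.smul_def, map_smul,
      map_smul]; rfl
  | of x =>
    intro T
    induction T with
    | zero => simp
    | add y z hy hz => rw [add_mul, map_add, map_add, hy, hz, map_add, map_add, smul_add]
    | tmul y z =>
      simp [-ι_apply, comul₀_ι, counit₀_ι, mul_add, antipodeLin_mul, antipodeLin_ι, mul_assoc]
  | add a b ha hb =>
    intro T
    rw [map_add, mul_add, map_add, map_add, ha, hb, map_add, add_smul]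
  | mul a b ha hb =>
    intro T
    rw [map_mul (comul₀ k), ← mul_assoc, hb, ha, map_mul, mul_comm, mul_smul]

instance : HopfAlgebra k (UniversalEnvelopingAlgebra k L) where
  antipode := antipodeLin k
  mul_antipode_rTensor_comul := by
    refine LinearMap.ext fun a => ?_
    have := antipode_left_aux k a 1
    rw [mul_one, Algebra.TensorProduct.one_def, LinearMap.rTensor_tmul, antipodeLin_one,
      LinearMap.mul'_apply, mul_one, ← Algebra.algebraMap_eq_smul_one] at this
    exact this
  mul_antipode_lTensor_comul := by
    refine LinearMap.ext fun a => ?_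
    have := antipode_right_aux k a 1
    rw [one_mul, Algebra.TensorProduct.one_def, LinearMap.lTensor_tmul, antipodeLin_one,
      LinearMap.mul'_apply, mul_one, ← Algebra.algebraMap_eq_smul_one] at this
    exact this

end

end UniversalEnvelopingAlgebra

/-! ### Formal Hopf algebras

For `k`-algebras `A` and `B`, the completed tensor product over `k⟦t⟧` of the topologically free
modules `A⟦t⟧` and `B⟦t⟧` is `(A ⊗ B)⟦t⟧`. The variable `t` is `PowerSeries.X`. -/

namespace Formal

section
variable (k : Type*) [CommRing k]
variable {A A' B B' : Type*} [Ring A] [Ring A'] [Ring B] [Ring B']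
variable [Algebra k A] [Algebra k A'] [Algebra k B] [Algebra k B']

/-- The structure map `k⟦t⟧ → A⟦t⟧` of the `k⟦t⟧`-algebra `A⟦t⟧`. -/
def scalar (A : Type*) [Ring A] [Algebra k A] : k⟦X⟧ →+* A⟦X⟧ :=
  PowerSeries.map (algebraMap k A)

/-- The inclusion of `A` in `A⟦t⟧` as constant power series. -/
def const (A : Type*) [Ring A] [Algebra k A] : A →ₗ[k] A⟦X⟧ where
  toFun := PowerSeries.C
  map_add' := map_add _
  map_smul' c a := by
    ext n
    rcases n with _ | n <;> simp [PowerSeries.coeff_C]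

/-- The coefficientwise extension `∑ aₙ tⁿ ↦ ∑ φ(aₙ) tⁿ` of a `k`-linear map. -/
def mapLin (φ : A →ₗ[k] B) : A⟦X⟧ →ₗ[k] B⟦X⟧ where
  toFun x := PowerSeries.mk fun n => φ (PowerSeries.coeff n x)
  map_add' x y := by ext n; simp
  map_smul' c x := by ext n; simp

/-- The `k⟦t⟧`-linear extension `∑ aₙ tⁿ ↦ ∑ φ(aₙ) tⁿ` of a `k`-linear map `φ : A → B⟦t⟧`. -/
def extend (φ : A →ₗ[k] B⟦X⟧) : A⟦X⟧ →ₗ[k] B⟦X⟧ where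
  toFun x := PowerSeries.mk fun n =>
    ∑ ij ∈ Finset.HasAntidiagonal.antidiagonal n, PowerSeries.coeff ij.2 (φ (PowerSeries.coeff ij.1 x))
  map_add' x y := by ext n; simp [Finset.sum_add_distrib]
  map_smul' c x := by ext n; simp [Finset.smul_sum]

/-- The tensor product of power series, as an element of the completed tensor product:
`(∑ aᵢ tⁱ) ⊗ (∑ bⱼ tʲ) = ∑ (aᵢ ⊗ bⱼ) tⁱ⁺ʲ`. -/
def tmul : A⟦X⟧ →ₗ[k] B⟦X⟧ →ₗ[k] (A ⊗[k] B)⟦X⟧ :=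
  (LinearMap.mul k (A ⊗[k] B)⟦X⟧).compl₁₂
    (PowerSeries.mapAlgHom (Algebra.TensorProduct.includeLeft : A →ₐ[k] A ⊗[k] B)).toLinearMap
    (PowerSeries.mapAlgHom (Algebra.TensorProduct.includeRight : B →ₐ[k] A ⊗[k] B)).toLinearMap

theorem coeff_tmul (x : A⟦X⟧) (y : B⟦X⟧) (n : ℕ) :
    PowerSeries.coeff n (tmul k x y) = ∑ ij ∈ Finset.HasAntidiagonal.antidiagonal n,
      PowerSeries.coeff ij.1 x ⊗ₜ[k] PowerSeries.coeff ij.2 y := by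
  simp [tmul, PowerSeries.coeff_mul, PowerSeries.mapAlgHom_apply]

/-- The completed tensor product `f ⊗ g : (A ⊗ A')⟦t⟧ → (B ⊗ B')⟦t⟧` of two `k⟦t⟧`-linear maps
`f : A⟦t⟧ → B⟦t⟧` and `g : A'⟦t⟧ → B'⟦t⟧`: the `k⟦t⟧`-linear map with
`a ⊗ a' ↦ f(a) ⊗ g(a')` for `a ∈ A` and `a' ∈ A'`. -/
def tensorMap (f : A⟦X⟧ →ₗ[k] B⟦X⟧) (g : A'⟦X⟧ →ₗ[k] B'⟦X⟧) :
    (A ⊗[k] A')⟦X⟧ →ₗ[k] (B ⊗[k] B')⟦X⟧ :=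
  extend k (TensorProduct.lift ((tmul k).compl₁₂ (f ∘ₗ const k A) (g ∘ₗ const k A')))

/-- The flip `a ⊗ b ↦ b ⊗ a` of `(A ⊗ A)⟦t⟧`. -/
def flip (A : Type*) [Ring A] [Algebra k A] : (A ⊗[k] A)⟦X⟧ →ₗ[k] (A ⊗[k] A)⟦X⟧ :=
  mapLin k (TensorProduct.comm k A A).toLinearMap

end

/-- A (topological) Hopf algebra structure over `k⟦t⟧` on the topologically free module `A⟦t⟧`
whose product and unit are the undeformed ones, that is, those of power series over `A`. -/
structure HopfStructure (k A : Type*) [CommRing k] [Ring A] [Algebra k A] where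
  /-- The coproduct, an algebra homomorphism to the completed tensor square. -/
  comul : A⟦X⟧ →ₐ[k] (A ⊗[k] A)⟦X⟧
  /-- The counit, an algebra homomorphism. -/
  counit : A⟦X⟧ →ₐ[k] k⟦X⟧
  /-- The antipode. -/
  antipode : A⟦X⟧ →ₗ[k] A⟦X⟧
  comul_scalar : ∀ c : k⟦X⟧, comul (scalar k A c) = scalar k (A ⊗[k] A) c
  counit_scalar : ∀ c : k⟦X⟧, counit (scalar k A c) = c
  antipode_scalar_mul : ∀ (c : k⟦X⟧) (x : A⟦X⟧),
    antipode (scalar k A c * x) = scalar k A c * antipode x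
  coassoc : ∀ x, mapLin k (TensorProduct.assoc k A A A).toLinearMap
      (tensorMap k comul.toLinearMap LinearMap.id (comul x)) =
    tensorMap k LinearMap.id comul.toLinearMap (comul x)
  counit_comul : ∀ x, mapLin k (TensorProduct.lid k A).toLinearMap
    (tensorMap k counit.toLinearMap LinearMap.id (comul x)) = x
  comul_counit : ∀ x, mapLin k (TensorProduct.rid k A).toLinearMap
    (tensorMap k LinearMap.id counit.toLinearMap (comul x)) = x
  antipode_left : ∀ x, mapLin k (LinearMap.mul' k A)
    (tensorMap k antipode LinearMap.id (comul x)) = scalar k A (counit x)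
  antipode_right : ∀ x, mapLin k (LinearMap.mul' k A)
    (tensorMap k LinearMap.id antipode (comul x)) = scalar k A (counit x)

/-- The Hopf structure is noncocommutative. -/
def HopfStructure.Noncocommutative {k A : Type*} [CommRing k] [Ring A] [Algebra k A]
    (H : HopfStructure k A) : Prop :=
  ∃ x, flip k A (H.comul x) ≠ H.comul x

/-- As `t` is central, the left ideal that it generates is the two-sided ideal `t A⟦t⟧`. -/
instance {A : Type*} [Ring A] :
    (Ideal.span {(PowerSeries.X : A⟦X⟧)} : Ideal A⟦X⟧).IsTwoSided where
  mul_mem_of_left b ha := by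
    obtain ⟨c, rfl⟩ := Ideal.mem_span_singleton'.mp ha
    rw [mul_assoc, (PowerSeries.commute_X b).symm.eq, ← mul_assoc]
    exact Ideal.mem_span_singleton'.mpr ⟨c * b, rfl⟩

/-! ### Drinfel'd twists -/

section
variable {k A : Type*} [CommRing k] [Ring A] [HopfAlgebra k A]

/-- An invertible element `𝓕` of `(A ⊗ A)⟦t⟧` is a Drinfel'd twist on `A⟦t⟧`, equipped with the
Hopf structure induced coefficientwise by that of `A`, if
`(𝓕 ⊗ 1)(Δ₀ ⊗ id)(𝓕) = (1 ⊗ 𝓕)(id ⊗ Δ₀)(𝓕)` and `(ε ⊗ id)(𝓕) = 1 = (id ⊗ ε)(𝓕)`. -/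
structure IsDrinfeldTwist (𝓕 : ((A ⊗[k] A)⟦X⟧)ˣ) : Prop where
  cocycle :
    PowerSeries.mapAlgHom (Algebra.TensorProduct.assoc k k k A A A).toAlgHom
      (PowerSeries.mapAlgHom
          (Algebra.TensorProduct.includeLeft : A ⊗[k] A →ₐ[k] (A ⊗[k] A) ⊗[k] A) 𝓕.val *
        PowerSeries.mapAlgHom
          (Algebra.TensorProduct.map (Bialgebra.comulAlgHom k A) (AlgHom.id k A)) 𝓕.val) =
    PowerSeries.mapAlgHom
        (Algebra.TensorProduct.includeRight : A ⊗[k] A →ₐ[k] A ⊗[k] (A ⊗[k] A)) 𝓕.val *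
      PowerSeries.mapAlgHom
        (Algebra.TensorProduct.map (AlgHom.id k A) (Bialgebra.comulAlgHom k A)) 𝓕.val
  counit_left : mapLin k ((TensorProduct.lid k A).toLinearMap ∘ₗ Coalgebra.counit.rTensor A) 𝓕.val = 1
  counit_right : mapLin k ((TensorProduct.rid k A).toLinearMap ∘ₗ Coalgebra.counit.lTensor A) 𝓕.val = 1

/-- `H` is the twisting by `𝓕` of the Hopf structure on `A⟦t⟧` induced coefficientwise by that of
`A`: `Δ(x) = 𝓕 Δ₀(x) 𝓕⁻¹`, the counit is undeformed, and `S(x) = w S₀(x) w⁻¹` where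
`w = m(id ⊗ S₀)(𝓕)` is invertible. -/
structure IsTwisting (𝓕 : ((A ⊗[k] A)⟦X⟧)ˣ) (H : HopfStructure k A) : Prop where
  comul_eq : ∀ x, H.comul x =
    𝓕.val * PowerSeries.mapAlgHom (Bialgebra.comulAlgHom k A) x * 𝓕⁻¹.val
  counit_eq : H.counit = PowerSeries.mapAlgHom (Bialgebra.counitAlgHom k A)
  antipode_eq : ∃ w : (A⟦X⟧)ˣ,
    w.val = mapLin k (LinearMap.mul' k A ∘ₗ (HopfAlgebra.antipode k (A := A)).lTensor A) 𝓕.val ∧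
    ∀ x, H.antipode x = w.val * mapLin k (HopfAlgebra.antipode k (A := A)) x * w⁻¹.val

/-- `H` deforms the Hopf algebra `A`: the map `∑ aₙ tⁿ ↦ a₀` induces an isomorphism of algebras
`A⟦t⟧ / t A⟦t⟧ ≅ A`, which takes the coproduct, the counit and the antipode of `H` modulo `t` to
those of `A`. -/
structure IsDeformation (H : HopfStructure k A) : Prop where
  quotient_equiv : ∃ φ : (A⟦X⟧ ⧸ (Ideal.span {PowerSeries.X} : Ideal A⟦X⟧)) ≃ₐ[k] A,
    ∀ x : A⟦X⟧, φ (Ideal.Quotient.mk _ x) = PowerSeries.constantCoeff x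
  comul_mod : ∀ x, PowerSeries.constantCoeff (H.comul x) =
    Coalgebra.comul (R := k) (PowerSeries.constantCoeff x)
  counit_mod : ∀ x, PowerSeries.constantCoeff (H.counit x) =
    Coalgebra.counit (R := k) (PowerSeries.constantCoeff x)
  antipode_mod : ∀ x, PowerSeries.constantCoeff (H.antipode x) =
    HopfAlgebra.antipode k (PowerSeries.constantCoeff x)

end

/-! ### Explicit elements -/

section
variable {k A : Type*} [Field k] [Ring A] [Algebra k A]

/-- The rising factorial `x_a^{(n)} = (x + a)(x + a + 1) ⋯ (x + a + n - 1)`. -/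
def rising (x : A) (a : k) : ℕ → A
  | 0 => 1
  | n + 1 => rising x a n * (x + algebraMap k A (a + n))

/-- The falling factorial `x_a^{[n]} = (x + a)(x + a - 1) ⋯ (x + a - n + 1)`. -/
def falling (x : A) (a : k) : ℕ → A
  | 0 => 1
  | n + 1 => falling x a n * (x + algebraMap k A (a - n))

/-- The power `(1 - e t)^a = ∑ₘ (-1)ᵐ (a choose m) eᵐ tᵐ`, where
`(a choose m) = a (a - 1) ⋯ (a - m + 1) / m!`. -/
def oneSubPow (e : A) (a : k) : A⟦X⟧ :=
  PowerSeries.mk fun m =>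
    ((-1) ^ m * ((∏ i ∈ Finset.range m, (a - i)) / (m.factorial : k))) • e ^ m

/-- The series `𝓕 = ∑ᵣ ((-1)ʳ / r!) h^{[r]} ⊗ eʳ tʳ`. -/
def twistSeries (k : Type*) {A : Type*} [Field k] [Ring A] [Algebra k A] (h e : A) :
    (A ⊗[k] A)⟦X⟧ :=
  PowerSeries.mk fun r =>
    ((-1) ^ r / (r.factorial : k)) • (falling h (0 : k) r ⊗ₜ[k] (e ^ r))

end

end Formal

namespace SchrodingerVirasoro

section
variable (F : Type*) [Field F] [CharZero F]

/-- The universal enveloping algebra of the Schrödinger–Virasoro Lie algebra. -/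
abbrev U : Type _ := UniversalEnvelopingAlgebra F (SchrodingerVirasoro F)

/-- The basis vector `Lₙ`, as an element of `U⟦t⟧`. -/
def Lt (n : ℤ) : (U F)⟦X⟧ := PowerSeries.C (UniversalEnvelopingAlgebra.ι F (L F n))

/-- The basis vector `Y_{j + 1/2}`, as an element of `U⟦t⟧`. -/
def Yt (j : ℤ) : (U F)⟦X⟧ := PowerSeries.C (UniversalEnvelopingAlgebra.ι F (Y F j))

/-- The basis vector `Mₙ`, as an element of `U⟦t⟧`. -/
def Mt (n : ℤ) : (U F)⟦X⟧ := PowerSeries.C (UniversalEnvelopingAlgebra.ι F (M F n))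

end

end SchrodingerVirasoro

end

/-!
The twist is `𝓕 = (1 - 1 ⊗ e t)^(h ⊗ 1)`, a binomial series whose exponent lies in the algebra, and
everything takes place in a Hopf algebra `A` over a field of characteristic zero with primitive
elements `h`, `e` such that `[h, e] = e`.

All identities between such series are proved by the same device. The Euler operator `t d/dt` is a
derivation of `A⟦t⟧`, and an equation `t U' = P U` with `P(0) = 0` determines `U` from its constant
term (`eq_of_euler_eq_mul`), also over a noncommutative `A`. The binomial series is the solution
with `P = -a ((1 - x t)⁻¹ - 1)` and `U(0) = 1` (`euler_binomialSeries`). Comparing differential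
equations gives the cocycle identity (`binomialSeries_cocycle`), the conjugate by `𝓕` of an
element `y` of the second tensor factor on which `ad e` is nilpotent
(`binomialSeries_mul_nilpotent`), and the conjugate of `y` by
`w = m(id ⊗ S₀)(𝓕) = ∑ (1 / r!) h^{[r]} eʳ tʳ`, which solves `t w' = h e t w`
(`binomialSeries_neg_mul`). In the first tensor factor, conjugation by `𝓕` only shifts the exponent,
as `ad h` acts on `y` by a scalar (`binomialSeries_mul_eigenvector`).

That a Drinfel'd twist yields a Hopf structure is proved for any Hopf algebra
(`twistHopfStructure`). Each of the maps involved is additive and commutes with `t`, so it is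
determined by its values on constants (`XAdditive.eq_of_C`); this turns the completed tensor products of the
twisted maps into conjugates of coefficientwise maps. The inverse of `w` is `m(S₀ ⊗ id)(𝓕⁻¹)`,
by contracting the cocycle condition along `a ⊗ b ⊗ c ↦ a S₀(b) c`
(`IsDrinfeldTwist.mul_eq_one`).

In the Schrödinger–Virasoro algebra, the `Lₙ`, `Y_p`, `Mₙ` are eigenvectors of `ad h`, and `ad e`
maps `Lₙ` to a multiple of a `Y`, each `Y_p` to a multiple of an `M`, and each `Mₙ` to zero, so the
general formulas specialize to the stated ones. Noncommutativity and noncocommutativity need `e` and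
`M₁` to be linearly independent in the enveloping algebra, which is seen from the adjoint action on
`L₀`.
-/

noncomputable section

namespace Formal

/-! ### The Euler operator on power series -/

section Euler

variable {A : Type*} [Ring A]

/-- The Euler operator `t d/dt`, that is `∑ aₙ tⁿ ↦ ∑ n aₙ tⁿ`. -/
def euler : A⟦X⟧ →+ A⟦X⟧ where
  toFun x := PowerSeries.mk fun n => n • PowerSeries.coeff n x
  map_zero' := by ext n; simp
  map_add' x y := by ext n; simp

theorem coeff_euler (x : A⟦X⟧) (n : ℕ) :
    PowerSeries.coeff n (euler x) = n • PowerSeries.coeff n x := by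
  simp [euler]

theorem euler_mul (x y : A⟦X⟧) : euler (x * y) = euler x * y + x * euler y := by
  ext n
  simp only [coeff_euler, map_add, PowerSeries.coeff_mul, Finset.smul_sum,
    ← Finset.sum_add_distrib]
  refine Finset.sum_congr rfl fun ij hij => ?_
  rw [← Finset.HasAntidiagonal.mem_antidiagonal.mp hij, add_smul, smul_mul_assoc, mul_smul_comm]

@[simp] theorem euler_C (a : A) : euler (PowerSeries.C a) = 0 := by
  ext n
  rw [coeff_euler, PowerSeries.coeff_C]
  split_ifs with h <;> simp [h]

@[simp] theorem euler_one : euler (1 : A⟦X⟧) = 0 := by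
  simpa using euler_C (1 : A)

@[simp] theorem euler_X : euler (PowerSeries.X : A⟦X⟧) = PowerSeries.X := by
  ext n
  rw [coeff_euler, PowerSeries.coeff_X]
  split_ifs with h <;> simp [h]

theorem X_mul_comm (x : A⟦X⟧) : PowerSeries.X * x = x * PowerSeries.X :=
  (PowerSeries.commute_X x).symm.eq

theorem C_mul_C (a b : A) : PowerSeries.C a * PowerSeries.C b = PowerSeries.C (a * b) :=
  (map_mul _ _ _).symm

/-- A formal linear differential equation `t U' = P U` with `P(0) = 0` has at most one solution
with a given constant term. -/
theorem eq_of_euler_eq_mul [IsAddTorsionFree A] {P U V : A⟦X⟧}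
    (hP : PowerSeries.constantCoeff P = 0) (hU : euler U = P * U) (hV : euler V = P * V)
    (h0 : PowerSeries.constantCoeff U = PowerSeries.constantCoeff V) : U = V := by
  ext n
  induction n using Nat.strong_induction_on with
  | _ n ih =>
    rcases Nat.eq_zero_or_pos n with rfl | hn
    · simpa using h0
    · refine nsmul_right_injective hn.ne' ?_
      have h := congrArg (PowerSeries.coeff n) hU
      have h' := congrArg (PowerSeries.coeff n) hV
      rw [coeff_euler, PowerSeries.coeff_mul] at h h'
      change n • _ = n • _
      rw [h, h']
      refine Finset.sum_congr rfl fun ij hij => ?_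
      rcases Nat.eq_zero_or_pos ij.1 with h1 | h1
      · simp [h1, hP]
      · have := Finset.HasAntidiagonal.mem_antidiagonal.mp hij
        rw [ih ij.2 (by omega)]

end Euler

/-! ### The geometric and the binomial series -/

section Geometric

variable {A : Type*} [Ring A]

/-- The geometric series `(1 - x t)⁻¹ = ∑ xⁿ tⁿ`. -/
def geometric (x : A) : A⟦X⟧ := PowerSeries.mk fun n => x ^ n

theorem geometric_mul (x : A) : geometric x * (1 - PowerSeries.C x * PowerSeries.X) = 1 := by
  ext n
  rw [mul_sub, mul_one, ← mul_assoc, map_sub]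
  rcases n with _ | n
  · simp [geometric]
  · rw [PowerSeries.coeff_succ_mul_X, PowerSeries.coeff_mul_C]
    simp [geometric, PowerSeries.coeff_one, pow_succ]

theorem mul_geometric (x : A) : (1 - PowerSeries.C x * PowerSeries.X) * geometric x = 1 := by
  ext n
  rw [sub_mul, one_mul, mul_assoc, map_sub]
  rcases n with _ | n
  · simp [geometric]
  · rw [PowerSeries.coeff_C_mul, PowerSeries.coeff_succ_X_mul]
    simp [geometric, PowerSeries.coeff_one, pow_succ']

theorem geometric_mul_C_mul_X (x : A) :
    geometric x * (PowerSeries.C x * PowerSeries.X) = geometric x - 1 := by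
  have := geometric_mul x
  rw [mul_sub, mul_one] at this
  rw [← this]; abel

@[simp] theorem constantCoeff_geometric (x : A) :
    PowerSeries.constantCoeff (geometric x) = 1 := by
  rw [← PowerSeries.coeff_zero_eq_constantCoeff_apply]; simp [geometric]

theorem euler_geometric (x : A) : euler (geometric x) = (geometric x - 1) * geometric x := by
  have h : euler (geometric x * (1 - PowerSeries.C x * PowerSeries.X)) = 0 := by
    rw [geometric_mul, euler_one]
  rw [euler_mul, map_sub, euler_one, euler_mul, euler_C, euler_X, zero_mul, zero_add, zero_sub,
    mul_neg, geometric_mul_C_mul_X, ← sub_eq_add_neg, sub_eq_zero] at h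
  rw [← h, mul_assoc, mul_geometric, mul_one]

theorem commute_geometric {x y : A} (h : Commute y x) :
    Commute (PowerSeries.C y) (geometric x) := by
  ext n
  simp [geometric, (h.pow_right n).eq]

/-- The commutator of `(1 - x t)⁻¹` with a constant. -/
theorem geometric_mul_C_sub (x y z : A) (h : x * y = y * x + z) :
    geometric x * PowerSeries.C y = PowerSeries.C y * geometric x +
      geometric x * PowerSeries.C z * geometric x * PowerSeries.X := by
  have key : (1 - PowerSeries.C x * PowerSeries.X) * PowerSeries.C y =
      PowerSeries.C y * (1 - PowerSeries.C x * PowerSeries.X) -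
        PowerSeries.C z * PowerSeries.X := by
    have hC := congrArg (PowerSeries.C (R := A)) h
    rw [map_mul, map_add, map_mul] at hC
    rw [sub_mul, one_mul, mul_assoc, X_mul_comm, ← mul_assoc, hC]
    noncomm_ring
  calc geometric x * PowerSeries.C y
      = geometric x * (PowerSeries.C y * (1 - PowerSeries.C x * PowerSeries.X)) *
          geometric x := by
        rw [mul_assoc, mul_assoc, mul_geometric, mul_one]
    _ = geometric x * ((1 - PowerSeries.C x * PowerSeries.X) * PowerSeries.C y +
          PowerSeries.C z * PowerSeries.X) * geometric x := by
        rw [key]; congr 2; abel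
    _ = _ := by
        rw [mul_add, ← mul_assoc, geometric_mul, one_mul, add_mul, mul_assoc (geometric x),
          mul_assoc (PowerSeries.C z), X_mul_comm]
        simp only [mul_assoc]

end Geometric

section Binomial

variable {k A : Type*} [Field k] [Ring A] [Algebra k A]

variable (k) in
/-- The binomial series `(1 - x t)^a = ∑ᵣ ((-1)ʳ / r!) a^{[r]} xʳ tʳ`, for an exponent `a` in the
algebra. -/
def binomialSeries (a x : A) : A⟦X⟧ :=
  PowerSeries.mk fun r => ((-1) ^ r / (r.factorial : k)) • (falling a (0 : k) r * x ^ r)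

@[simp] theorem constantCoeff_binomialSeries (a x : A) :
    PowerSeries.constantCoeff (binomialSeries k a x) = 1 := by
  rw [← PowerSeries.coeff_zero_eq_constantCoeff_apply]; simp [binomialSeries, falling]

/-- The twist is the series `(1 - e t)^h`, with `h` in the first and `e` in the second tensor
factor. -/
theorem twistSeries_eq (h e : A) :
    twistSeries k h e = binomialSeries k (h ⊗ₜ[k] (1 : A)) ((1 : A) ⊗ₜ[k] e) := by
  have hf : ∀ r, falling (h ⊗ₜ[k] (1 : A)) (0 : k) r = falling h (0 : k) r ⊗ₜ[k] (1 : A) := by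
    intro r
    induction r with
    | zero => rfl
    | succ r ih =>
      rw [falling, falling, ih, Algebra.TensorProduct.algebraMap_apply, ← TensorProduct.add_tmul,
        Algebra.TensorProduct.tmul_mul_tmul, mul_one]
  ext r
  simp [twistSeries, binomialSeries, hf, Algebra.TensorProduct.tmul_pow]

theorem falling_algebraMap (a : k) (r : ℕ) :
    falling (algebraMap k A a) (0 : k) r = algebraMap k A (∏ i ∈ Finset.range r, (a - i)) := by
  induction r with
  | zero => simp [falling]
  | succ r ih =>
    rw [falling, ih, Finset.prod_range_succ, ← map_add, ← map_mul, zero_sub, sub_eq_add_neg]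

theorem oneSubPow_eq (e : A) (a : k) :
    oneSubPow e a = binomialSeries k (algebraMap k A a) e := by
  ext r
  simp only [oneSubPow, binomialSeries, PowerSeries.coeff_mk, falling_algebraMap,
    ← Algebra.smul_def, smul_smul]
  congr 1
  ring

theorem commute_falling {a b : A} (h : Commute b a) (c : k) (r : ℕ) :
    Commute b (falling a c r) := by
  induction r with
  | zero => exact Commute.one_right b
  | succ r ih => exact ih.mul_right (h.add_right (Algebra.commutes _ _).symm)

theorem commute_binomialSeries {a x y : A} (ha : Commute y a) (hx : Commute y x) :
    Commute (PowerSeries.C y) (binomialSeries k a x) := by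
  ext r
  simp only [binomialSeries, PowerSeries.coeff_C_mul, PowerSeries.coeff_mul_C,
    PowerSeries.coeff_mk, mul_smul_comm, smul_mul_assoc,
    ((commute_falling ha (0 : k) r).mul_right (hx.pow_right r)).eq]

/-- If `a y = y (a + c)` then `(1 - x t)^a y = y (1 - x t)^(a + c)`. -/
theorem binomialSeries_mul_C {a x y : A} {c : k} (ha : a * y = y * (a + algebraMap k A c))
    (hx : Commute x y) :
    binomialSeries k a x * PowerSeries.C y =
      PowerSeries.C y * binomialSeries k (a + algebraMap k A c) x := by
  have hf : ∀ r, falling a (0 : k) r * y = y * falling (a + algebraMap k A c) (0 : k) r := by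
    intro r
    induction r with
    | zero => simp [falling]
    | succ r ih =>
      rw [falling, falling, mul_assoc, add_mul, ha, Algebra.commutes, ← mul_add, ← mul_assoc, ih,
        mul_assoc]
  ext r
  simp only [binomialSeries, PowerSeries.coeff_C_mul, PowerSeries.coeff_mul_C,
    PowerSeries.coeff_mk, mul_smul_comm, smul_mul_assoc]
  rw [mul_assoc, (hx.pow_left r).eq, ← mul_assoc, hf, mul_assoc]

/-- If `x` raises the degree for `d` by one, then the commutator with `d` acts on `(1 - x t)^a` as
the Euler operator. -/
theorem C_mul_binomialSeries {a x d : A} (ha : Commute d a) (hx : d * x = x * (d + 1)) :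
    PowerSeries.C d * binomialSeries k a x =
      binomialSeries k a x * PowerSeries.C d + euler (binomialSeries k a x) := by
  have hp : ∀ r : ℕ, d * x ^ r = x ^ r * d + r • x ^ r := by
    intro r
    induction r with
    | zero => simp
    | succ r ih =>
      rw [pow_succ, ← mul_assoc, ih, add_mul, mul_assoc, hx, succ_nsmul, smul_mul_assoc]
      noncomm_ring
  ext r
  simp only [binomialSeries, PowerSeries.coeff_C_mul, PowerSeries.coeff_mul_C, map_add,
    coeff_euler, PowerSeries.coeff_mk, mul_smul_comm, smul_mul_assoc]
  rw [← mul_assoc, (commute_falling ha 0 r).eq, mul_assoc, hp, mul_add, smul_add,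
    mul_smul_comm, mul_assoc, smul_comm]

variable [CharZero k]

/-- The differential equation of the binomial series, `t B' = -a x t (1 - x t)⁻¹ B`. -/
theorem euler_binomialSeries {a x : A} (h : Commute a x) :
    euler (binomialSeries k a x) =
      -(PowerSeries.C a * (geometric x - 1)) * binomialSeries k a x := by
  set B := binomialSeries k a x with hB
  -- The equation multiplied by `1 - x t` is a two-term recursion for the coefficients.
  have key : (1 - PowerSeries.C x * PowerSeries.X) * euler B =
      -(PowerSeries.C (a * x) * PowerSeries.X) * B := by
    ext n
    rw [sub_mul, one_mul, mul_assoc, map_sub, neg_mul, map_neg, mul_assoc,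
      PowerSeries.coeff_C_mul, PowerSeries.coeff_C_mul]
    rcases n with _ | n
    · simp [coeff_euler]
    rw [PowerSeries.coeff_succ_X_mul, PowerSeries.coeff_succ_X_mul, coeff_euler, coeff_euler]
    have hr : (n + 1) • PowerSeries.coeff (n + 1) B =
        -((a - algebraMap k A n) * x * PowerSeries.coeff n B) := by
      have hc : Commute ((a - algebraMap k A n) * x) (falling a (0 : k) n) :=
        commute_falling ((Commute.sub_left (Commute.refl a) (Algebra.commutes _ _)).mul_left h.symm)
          0 n
      simp only [hB, binomialSeries, PowerSeries.coeff_mk, mul_smul_comm]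
      rw [← mul_assoc, hc.eq, falling, Nat.factorial_succ, pow_succ, zero_sub,
        ← Nat.cast_smul_eq_nsmul k, smul_smul, ← smul_neg, pow_succ' x]
      have hn : ((n : k) + 1) ≠ 0 := by exact_mod_cast n.succ_ne_zero
      have hf : (n.factorial : k) ≠ 0 := by exact_mod_cast n.factorial_ne_zero
      have : ((n + 1 : ℕ) : k) * ((-1) ^ n * -1 / ((n + 1) * n.factorial : ℕ)) =
          -((-1) ^ n / (n.factorial : k)) := by
        push_cast
        field_simp
      rw [this, neg_smul, smul_neg, map_neg, ← sub_eq_add_neg]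
      simp only [mul_assoc]
    rw [hr]
    rw [map_natCast, nsmul_eq_mul, sub_mul, sub_mul, (Nat.cast_commute n x).eq]
    simp only [mul_assoc]
    abel
  have := congrArg (geometric x * ·) key
  simp only [← mul_assoc, geometric_mul, one_mul] at this
  rw [this, h.eq, map_mul, mul_assoc (PowerSeries.C x), ← X_mul_comm, ← mul_assoc (PowerSeries.C x),
    mul_neg, ← mul_assoc, geometric_mul_C_mul_X,
    ((commute_geometric h).sub_right (Commute.one_right _)).eq]

end Binomial

/-! ### Identities for binomial series -/

theorem commute_of_coeff {A : Type*} [Ring A] {U V : A⟦X⟧}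
    (h : ∀ i j, Commute (PowerSeries.coeff i U) (PowerSeries.coeff j V)) : Commute U V := by
  ext n
  rw [PowerSeries.coeff_mul, PowerSeries.coeff_mul, ← Finset.Nat.sum_antidiagonal_swap]
  exact Finset.sum_congr rfl fun ij _ => h _ _

/-- In an algebra over a field of characteristic zero, nonzero integers can be cancelled. -/
theorem isAddTorsionFree_of_algebra (k A : Type*) [Field k] [CharZero k] [Ring A] [Algebra k A] :
    IsAddTorsionFree A where
  nsmul_right_injective n hn x y hxy := by
    have hn' : (n : k) ≠ 0 := by exact_mod_cast hn
    have h : (n : k) • x = (n : k) • y := by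
      simpa only [Nat.cast_smul_eq_nsmul] using hxy
    exact smul_right_injective A hn' h

section BinomialIdentities

variable {k A : Type*} [Field k] [Ring A] [Algebra k A]

theorem commute_geometric_binomialSeries {a x y : A} (ha : Commute y a) (hx : Commute y x) :
    Commute (geometric y) (binomialSeries k a x) := by
  refine commute_of_coeff fun i j => ?_
  simp only [geometric, binomialSeries, PowerSeries.coeff_mk]
  exact (((commute_falling ha 0 j).mul_right (hx.pow_right j)).pow_left i).smul_right _

variable [CharZero k]

theorem eq_binomialSeries {a x : A} (h : Commute a x) {U : A⟦X⟧}
    (hU : euler U = -(PowerSeries.C a * (geometric x - 1)) * U)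
    (h0 : PowerSeries.constantCoeff U = 1) : U = binomialSeries k a x := by
  have := isAddTorsionFree_of_algebra k A
  exact eq_of_euler_eq_mul (by simp) hU (euler_binomialSeries h) (by simp [h0])

theorem binomialSeries_add {a b x : A} (hab : Commute a b) (ha : Commute a x) (hb : Commute b x) :
    binomialSeries k (a + b) x = binomialSeries k a x * binomialSeries k b x := by
  refine (eq_binomialSeries (ha.add_left hb) ?_ (by simp)).symm
  have h1 : Commute (binomialSeries k a x) (PowerSeries.C b * (geometric x - 1)) :=
    (commute_binomialSeries hab.symm hb).symm.mul_right
      (Commute.sub_right (commute_geometric_binomialSeries ha.symm (Commute.refl x)).symm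
        (Commute.one_right _))
  rw [euler_mul, euler_binomialSeries ha, euler_binomialSeries hb, ← mul_assoc, mul_neg, h1.eq,
    map_add]
  noncomm_ring

theorem oneSubPow_add (x : A) (a b : k) :
    oneSubPow x (a + b) = oneSubPow x a * oneSubPow x b := by
  rw [oneSubPow_eq, oneSubPow_eq, oneSubPow_eq, map_add]
  exact binomialSeries_add (Algebra.commutes _ _) (Algebra.commutes _ _) (Algebra.commutes _ _)

theorem binomialSeries_add_algebraMap {a x : A} (ha : Commute a x) (b : k) :
    binomialSeries k (a + algebraMap k A b) x = oneSubPow x b * binomialSeries k a x := by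
  rw [add_comm, oneSubPow_eq]
  exact binomialSeries_add (Algebra.commutes _ _) (Algebra.commutes _ _) ha

theorem oneSubPow_one (x : A) :
    oneSubPow x (1 : k) = 1 - PowerSeries.C x * PowerSeries.X := by
  rw [oneSubPow_eq]
  refine (eq_binomialSeries (Algebra.commutes _ _) ?_ (by simp)).symm
  rw [map_sub, euler_one, euler_mul, euler_C, euler_X, map_one, map_one, one_mul, neg_mul, sub_mul,
    geometric_mul, one_mul]
  noncomm_ring

theorem oneSubPow_neg_one (x : A) : oneSubPow x (-1 : k) = geometric x := by
  rw [oneSubPow_eq]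
  refine (eq_binomialSeries (Algebra.commutes _ _) ?_ (by simp)).symm
  rw [euler_geometric, map_neg, map_neg, map_one, map_one]
  noncomm_ring

theorem oneSubPow_neg_two (x : A) : oneSubPow x (-2 : k) = geometric x * geometric x := by
  rw [← oneSubPow_neg_one (k := k), ← oneSubPow_add]
  norm_num

/-- If `[a, y] = c y` and `x` commutes with `y`, then conjugation by `(1 - x t)^a` multiplies `y` by
`(1 - x t)^c`. -/
theorem binomialSeries_mul_eigenvector {a x y : A} {c : k} (hax : Commute a x)
    (ha : a * y = y * (a + algebraMap k A c)) (hx : Commute x y) :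
    binomialSeries k a x * PowerSeries.C y =
      PowerSeries.C y * oneSubPow x c * binomialSeries k a x := by
  rw [binomialSeries_mul_C ha hx, binomialSeries_add_algebraMap hax, mul_assoc]

/-- The identity behind the cocycle condition of the twist: for `hᵢ` and `eᵢ` in the `i`-th
tensor factor, both sides solve
`t U' = -(h₁ ((1 - e₂ t)⁻¹ (1 - e₃ t)⁻¹ - 1) + h₂ ((1 - e₃ t)⁻¹ - 1)) U`. -/
theorem binomialSeries_cocycle {h₁ h₂ e₂ e₃ : A} (hh : Commute h₁ h₂) (h12 : Commute h₁ e₂)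
    (h13 : Commute h₁ e₃) (h23 : Commute h₂ e₃) (he : Commute e₂ e₃)
    (h22 : h₂ * e₂ = e₂ * (h₂ + 1)) :
    binomialSeries k h₁ e₂ * binomialSeries k (h₁ + h₂) e₃ =
      binomialSeries k h₂ e₃ * binomialSeries k h₁ (e₂ + e₃) := by
  have := isAddTorsionFree_of_algebra k A
  refine eq_of_euler_eq_mul (P := -(PowerSeries.C h₁ * (geometric e₂ * geometric e₃ - 1)) -
    PowerSeries.C h₂ * (geometric e₃ - 1)) (by simp) ?_ ?_ (by simp)
  · have d1 := euler_binomialSeries (k := k) h12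
    have d2 := euler_binomialSeries (k := k) (h13.add_left h23)
    have c1 := (commute_geometric_binomialSeries (k := k) h13.symm he.symm).eq
    have c2 := C_mul_binomialSeries (k := k) hh.symm h22
    have c3 := (commute_binomialSeries (k := k) (Commute.refl h₁) h12).eq
    rw [map_add] at d2
    rw [euler_mul]
    set B := binomialSeries k h₁ e₂
    set B' := binomialSeries k (h₁ + h₂) e₃
    linear_combination (norm := noncomm_ring) d1 * B' + B * d2 + c2 * (geometric e₃ - 1) * B' +
      c3 * (geometric e₃ - 1) * B' + d1 * (geometric e₃ - 1) * B' +
      (PowerSeries.C h₁ * geometric e₂ + PowerSeries.C h₂) * c1 * B'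
  · have d1 := euler_binomialSeries (k := k) h23
    have d2 := euler_binomialSeries (k := k) (h12.add_right h13)
    have c1 : binomialSeries k h₂ e₃ * PowerSeries.C e₂ =
        PowerSeries.C e₂ * oneSubPow e₃ (1 : k) * binomialSeries k h₂ e₃ :=
      binomialSeries_mul_eigenvector h23 (by rw [h22, map_one]) he.symm
    rw [oneSubPow_one] at c1
    have c2 := (commute_binomialSeries (k := k) h23.symm (Commute.refl e₃)).eq
    have c3 := (commute_binomialSeries (k := k) hh h13).eq
    have c4 := X_mul_comm (binomialSeries k h₂ e₃)
    have g := mul_geometric (e₂ + e₃)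
    have g2 := geometric_mul e₂
    have g3 := geometric_mul e₃
    have gc : geometric e₂ * geometric e₃ = geometric e₃ * geometric e₂ := by
      refine (commute_of_coeff fun i j => ?_).eq
      simp only [geometric, PowerSeries.coeff_mk]
      exact he.pow_pow i j
    have x3 := X_mul_comm (PowerSeries.C e₃)
    rw [map_add] at g
    rw [euler_mul]
    set B := binomialSeries k h₂ e₃
    set B' := binomialSeries k h₁ (e₂ + e₃)
    -- Conjugation by `(1 - e₃ t)^h₂` takes `1 - (e₂ + e₃) t` to `(1 - e₂ t) (1 - e₃ t)`.
    have key : B * geometric (e₂ + e₃) = geometric e₃ * geometric e₂ * B := by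
      have k1 : B * (1 - (PowerSeries.C e₂ + PowerSeries.C e₃) * PowerSeries.X) =
          (1 - PowerSeries.C e₂ * PowerSeries.X) * (1 - PowerSeries.C e₃ * PowerSeries.X) * B := by
        linear_combination (norm := noncomm_ring) -c1 * PowerSeries.X + c2 * PowerSeries.X +
          PowerSeries.C e₂ * (1 - PowerSeries.C e₃ * PowerSeries.X) * c4 +
          PowerSeries.C e₃ * c4 - PowerSeries.C e₂ * x3 * PowerSeries.X * B
      linear_combination (norm := noncomm_ring)
        geometric e₃ * geometric e₂ * B * g -
        geometric e₃ * geometric e₂ * k1 * geometric (e₂ + e₃) -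
        geometric e₃ * g2 * (1 - PowerSeries.C e₃ * PowerSeries.X) * B * geometric (e₂ + e₃) -
        g3 * B * geometric (e₂ + e₃)
    linear_combination (norm := noncomm_ring) d1 * B' + B * d2 +
      c3 * (geometric (e₂ + e₃) - 1) * B' - PowerSeries.C h₁ * key * B' +
      PowerSeries.C h₁ * gc * B * B'

/-- Conjugation by `(1 - x t)^a` of an element on which `ad x` is nilpotent, for a central
exponent `a`. -/
theorem binomialSeries_mul_nilpotent {a x y₀ y₁ y₂ : A} (hax : Commute a x)
    (ha0 : Commute a y₀) (ha1 : Commute a y₁) (ha2 : Commute a y₂)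
    (h0 : x * y₀ = y₀ * x + y₁) (h1 : x * y₁ = y₁ * x + (y₂ + y₂)) (h2 : Commute x y₂) :
    binomialSeries k a x * PowerSeries.C y₀ =
      (PowerSeries.C y₀ - PowerSeries.C a * (geometric x * PowerSeries.C y₁ * PowerSeries.X) +
        PowerSeries.C (a * (a + 1)) *
          (geometric x * geometric x * PowerSeries.C y₂ * PowerSeries.X ^ 2)) *
      binomialSeries k a x := by
  have := isAddTorsionFree_of_algebra k A
  have d := euler_binomialSeries (k := k) hax
  refine eq_of_euler_eq_mul (P := -(PowerSeries.C a * (geometric x - 1))) (by simp) ?_ ?_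
    (by simp)
  · rw [euler_mul, euler_C, d]; noncomm_ring
  -- Move `a` to the left and `t` to the right, and normalize `yᵢ (1 - x t)⁻¹`.
  have c0 : PowerSeries.C y₀ * geometric x = geometric x * PowerSeries.C y₀ -
      geometric x * PowerSeries.C y₁ * geometric x * PowerSeries.X :=
    eq_sub_of_add_eq (geometric_mul_C_sub x y₀ y₁ h0).symm
  have c1 : PowerSeries.C y₁ * geometric x = geometric x * PowerSeries.C y₁ -
      geometric x * PowerSeries.C (y₂ + y₂) * geometric x * PowerSeries.X :=
    eq_sub_of_add_eq (geometric_mul_C_sub x y₁ (y₂ + y₂) h1).symm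
  have c2 := (commute_geometric (y := y₂) h2.symm).eq
  have a0 := (ha0.map (PowerSeries.C (R := A))).eq.symm
  have a1 := (ha1.map (PowerSeries.C (R := A))).eq.symm
  have a2 := (ha2.map (PowerSeries.C (R := A))).eq.symm
  have ag := (commute_geometric hax).eq.symm
  have ta := X_mul_comm (PowerSeries.C a)
  have tg := X_mul_comm (geometric x)
  have assoc : ∀ {p q r : A⟦X⟧}, p * q = r → ∀ w, p * (q * w) = r * w :=
    fun h w => by rw [← mul_assoc, h]
  simp only [euler_mul, euler_C, map_add, map_sub, pow_two, euler_X, d, euler_geometric, map_mul,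
    map_one] at c1 ⊢
  simp only [mul_add, add_mul, mul_sub, sub_mul, neg_mul, mul_neg, mul_one, one_mul, mul_assoc,
    zero_mul, mul_zero, euler_one, c1, c2, assoc a0, assoc a1, assoc a2,
    assoc ag, assoc ta, assoc tg, assoc c0, assoc c1, assoc c2]
  abel

end BinomialIdentities

/-! ### Conjugation by the normally ordered series -/

section NormallyOrdered

variable {k A : Type*} [Field k] [Ring A] [Algebra k A]

/-- Moving `e` to the left of a falling factorial of `h` shifts it:
`h^{[r + 1]} e = h e h^{[r]}`. -/
theorem falling_succ_mul {h e : A} (he : h * e = e * (h + 1)) (r : ℕ) :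
    falling h (0 : k) (r + 1) * e = h * e * falling h (0 : k) r := by
  induction r with
  | zero => simp [falling]
  | succ r ih =>
    have h1 : (h + algebraMap k A (0 - (r + 1 : ℕ))) * e =
        e * (h + algebraMap k A (0 - (r : ℕ))) := by
      rw [add_mul, he, Algebra.commutes, ← mul_add, add_assoc]
      congr 2
      rw [← map_one (algebraMap k A), ← map_add]
      congr 1
      push_cast
      ring
    rw [falling, mul_assoc, h1, ← mul_assoc, ih, mul_assoc, mul_assoc, mul_assoc, ← falling]

variable [CharZero k]

/-- The series `w = ∑ᵣ (1 / r!) h^{[r]} eʳ tʳ`, where `[h, e] = e`, solves `t w' = h e t w`. -/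
theorem euler_binomialSeries_neg {h e : A} (he : h * e = e * (h + 1)) :
    euler (binomialSeries k h (-e)) =
      PowerSeries.C (h * e) * PowerSeries.X * binomialSeries k h (-e) := by
  ext n
  rw [coeff_euler, mul_assoc, PowerSeries.coeff_C_mul]
  rcases n with _ | n
  · simp
  have hw : ∀ r, PowerSeries.coeff r (binomialSeries k h (-e)) =
      (r.factorial : k)⁻¹ • (falling h (0 : k) r * e ^ r) := by
    intro r
    have hs : (-e) ^ r = ((-1 : k) ^ r) • e ^ r := by
      rw [← neg_one_smul k e, smul_pow]
    rw [binomialSeries, PowerSeries.coeff_mk, hs, mul_smul_comm, smul_smul]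
    congr 1
    rw [div_mul_eq_mul_div, ← mul_pow]
    simp
  rw [PowerSeries.coeff_succ_X_mul, hw, hw, mul_smul_comm, ← mul_assoc, ← falling_succ_mul he,
    pow_succ', mul_assoc, ← Nat.cast_smul_eq_nsmul k, smul_smul, Nat.factorial_succ]
  congr 1
  have hn : ((n : k) + 1) ≠ 0 := by exact_mod_cast n.succ_ne_zero
  have hf : (n.factorial : k) ≠ 0 := by exact_mod_cast n.factorial_ne_zero
  push_cast
  field_simp

/-- Let `w = ∑ᵣ (1 / r!) h^{[r]} eʳ tʳ`. If `y₀` has weight `c` for `ad h`, and `ad e` takes `y₀` to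
`y₁`, `y₁` to `2 y₂`, and `y₂` to zero, then
`w y₀ w⁻¹ = (1 - e t)⁻ᶜ (y₀ + y₁ (h + 1) t + y₂ (h + 2) (h + 1) t²)`. -/
theorem binomialSeries_neg_mul {h e y₀ y₁ y₂ : A} {c : k} (he : h * e = e * (h + 1))
    (w0 : h * y₀ = y₀ * (h + algebraMap k A c))
    (w1 : h * y₁ = y₁ * (h + algebraMap k A c + 1))
    (w2 : h * y₂ = y₂ * (h + algebraMap k A c + 2))
    (h0 : e * y₀ = y₀ * e + y₁) (h1 : e * y₁ = y₁ * e + (y₂ + y₂)) (h2 : Commute e y₂) :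
    binomialSeries k h (-e) * PowerSeries.C y₀ =
      oneSubPow e (-c) * (PowerSeries.C y₀ +
        PowerSeries.C y₁ * PowerSeries.C (falling h (1 : k) 1) * PowerSeries.X +
        PowerSeries.C y₂ * PowerSeries.C (falling h (2 : k) 2) * PowerSeries.X ^ 2) *
      binomialSeries k h (-e) := by
  have := isAddTorsionFree_of_algebra k A
  have dw := euler_binomialSeries_neg (k := k) he
  set w := binomialSeries k h (-e)
  set γ := algebraMap k A c with hγ
  have f1 : falling h (1 : k) 1 = h + 1 := by simp [falling]
  have f2 : falling h (2 : k) 2 = (h + 2) * (h + 1) := by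
    have : (2 : k) - 1 = 1 := by norm_num
    simp [falling, this, map_ofNat]
  -- The coefficients of `t`, `t²` and `t³` in `Q h e t + t Q' = (h - c) e t Q`, where `Q` is the
  -- polynomial in `t` that stands between `(1 - e t)⁻ᶜ` and `w`. This equation is what remains of
  -- the differential equation of the right-hand side after moving `h` across `(1 - e t)⁻ᶜ`.
  have hc : ∀ z : A, γ * z = z * γ := fun z => Algebra.commutes c z
  have p1 : y₀ * (h * e) + y₁ * (h + 1) = (h - γ) * e * y₀ := by
    rw [sub_mul, he, hc, sub_mul]
    have a1 : e * (h + 1) * y₀ = e * y₀ * (h + γ + 1) := by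
      rw [mul_assoc, add_mul, w0]; noncomm_ring
    have a2 : e * γ * y₀ = e * y₀ * γ := by rw [mul_assoc, hc, mul_assoc]
    rw [a1, a2, h0]; noncomm_ring
  have p2 : y₁ * (h + 1) * (h * e) + (y₂ * ((h + 2) * (h + 1)) + y₂ * ((h + 2) * (h + 1))) =
      (h - γ) * e * (y₁ * (h + 1)) := by
    rw [sub_mul, he, hc, sub_mul]
    have a1 : e * (h + 1) * (y₁ * (h + 1)) = e * y₁ * (h + γ + 2) * (h + 1) := by
      have : (h + 1) * y₁ = y₁ * (h + γ + 2) := by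
        rw [add_mul, w1, one_mul]; noncomm_ring
      simp only [← mul_assoc]
      rw [mul_assoc e, this]; simp only [mul_assoc]
    have a2 : e * γ * (y₁ * (h + 1)) = e * y₁ * γ * (h + 1) := by
      rw [mul_assoc, ← mul_assoc γ, hc]; simp only [mul_assoc]
    have a3 : (h + 1) * (e * (h + 1)) = e * (h + 2) * (h + 1) := by
      rw [← mul_assoc, add_mul, he]; noncomm_ring
    rw [a1, a2, h1, mul_assoc, a3]; noncomm_ring
  have p3 : y₂ * ((h + 2) * (h + 1)) * (h * e) = (h - γ) * e * (y₂ * ((h + 2) * (h + 1))) := by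
    rw [sub_mul, he, hc, sub_mul]
    have a1 : e * (h + 1) * (y₂ * ((h + 2) * (h + 1))) =
        y₂ * e * (h + γ + 3) * ((h + 2) * (h + 1)) := by
      have : (h + 1) * y₂ = y₂ * (h + γ + 3) := by
        rw [add_mul, w2, one_mul]; noncomm_ring
      rw [← mul_assoc, mul_assoc e, this, ← mul_assoc e, h2.eq]
    have a2 : e * γ * (y₂ * ((h + 2) * (h + 1))) = y₂ * e * γ * ((h + 2) * (h + 1)) := by
      rw [← mul_assoc, mul_assoc e, hc, ← mul_assoc e, h2.eq]
    have a3 : (h + 2) * ((h + 1) * (e * (h + 1))) = e * (h + 3) * ((h + 2) * (h + 1)) := by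
      have b1 : (h + 1) * e = e * (h + 2) := by rw [add_mul, he]; noncomm_ring
      have b2 : (h + 2) * e = e * (h + 3) := by rw [add_mul, he]; noncomm_ring
      rw [← mul_assoc (h + 1), b1, ← mul_assoc, ← mul_assoc, b2]; noncomm_ring
    rw [a1, a2, mul_assoc, mul_assoc, a3]; noncomm_ring
  rw [f1, f2]
  have dE := euler_binomialSeries (k := k) (a := algebraMap k A (-c)) (x := e)
    (Algebra.commutes _ _)
  have cE := C_mul_binomialSeries (k := k) (a := algebraMap k A (-c)) (Algebra.commutes _ _).symm he
  have ce := (commute_binomialSeries (k := k) (a := algebraMap k A (-c))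
    (Algebra.commutes _ _).symm (Commute.refl e)).eq
  have cg := (commute_geometric_binomialSeries (k := k) (a := algebraMap k A (-c))
    (Algebra.commutes _ _).symm (Commute.refl e)).eq
  have cγ := (commute_binomialSeries (k := k) (y := γ) (a := algebraMap k A (-c)) (x := e)
    (Algebra.commutes _ _) (Algebra.commutes _ _)).eq
  rw [← oneSubPow_eq] at dE cE ce cg cγ
  rw [map_neg, map_neg, ← hγ] at dE
  have h00 : PowerSeries.constantCoeff (oneSubPow e (-c)) = 1 := by
    rw [oneSubPow_eq, constantCoeff_binomialSeries]
  set E := oneSubPow e (-c)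
  refine eq_of_euler_eq_mul (P := PowerSeries.C (h * e) * PowerSeries.X) (by simp) ?_ ?_
    (by simp [h00, w])
  · rw [euler_mul, euler_C, dw]; noncomm_ring
  have g1 := geometric_mul_C_mul_X e
  set G := geometric e
  set t : A⟦X⟧ := PowerSeries.X with ht
  set Q := PowerSeries.C y₀ + PowerSeries.C y₁ * PowerSeries.C (h + 1) * t +
    PowerSeries.C y₂ * PowerSeries.C ((h + 2) * (h + 1)) * t ^ 2 with hQ
  have tc : ∀ z, t * z = z * t := X_mul_comm
  have polynomial_eq : Q * (PowerSeries.C (h * e) * t) + euler Q =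
      PowerSeries.C ((h - γ) * e) * t * Q := by
    have q1 := congrArg (PowerSeries.C (R := A)) p1
    have q2 := congrArg (PowerSeries.C (R := A)) p2
    have q3 := congrArg (PowerSeries.C (R := A)) p3
    rw [map_add, map_mul, map_mul _ ((h - γ) * e), map_mul _ y₁] at q1
    rw [map_add, map_add, map_mul, map_mul _ ((h - γ) * e), map_mul _ y₁, map_mul _ y₂] at q2
    rw [map_mul, map_mul _ ((h - γ) * e), map_mul _ y₂] at q3
    have dQ : euler Q = PowerSeries.C y₁ * PowerSeries.C (h + 1) * t +
        (PowerSeries.C y₂ * PowerSeries.C ((h + 2) * (h + 1)) +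
          PowerSeries.C y₂ * PowerSeries.C ((h + 2) * (h + 1))) * t ^ 2 := by
      rw [hQ]
      simp only [map_add, euler_mul, euler_C, pow_two, ht, euler_X]
      noncomm_ring
    rw [dQ, hQ]
    generalize PowerSeries.C ((h - γ) * e) = D at *
    generalize PowerSeries.C (h * e) = D' at *
    linear_combination (norm := noncomm_ring) q1 * t + q2 * t ^ 2 + q3 * t ^ 3 +
      PowerSeries.C y₁ * PowerSeries.C (h + 1) * tc D' * t +
      PowerSeries.C y₂ * PowerSeries.C ((h + 2) * (h + 1)) * t * tc D' * t +
      PowerSeries.C y₂ * PowerSeries.C ((h + 2) * (h + 1)) * tc D' * t * t -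
      D * tc (PowerSeries.C y₀) - D * tc (PowerSeries.C y₁ * PowerSeries.C (h + 1)) * t -
      D * tc (PowerSeries.C y₂ * PowerSeries.C ((h + 2) * (h + 1))) * t ^ 2
  have hD : PowerSeries.C ((h - γ) * e) = PowerSeries.C h * PowerSeries.C e -
      PowerSeries.C γ * PowerSeries.C e := by rw [map_mul, map_sub, sub_mul]
  have hD' : PowerSeries.C (h * e) = PowerSeries.C h * PowerSeries.C e := map_mul _ _ _
  rw [dE] at cE
  rw [euler_mul, euler_mul, dw, dE]
  rw [hD] at polynomial_eq
  rw [hD'] at polynomial_eq ⊢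
  linear_combination (norm := noncomm_ring) E * polynomial_eq * w -
    cE * PowerSeries.C e * t * Q * w - PowerSeries.C h * PowerSeries.C e * tc E * Q * w -
    PowerSeries.C h * ce * t * Q * w + cγ * PowerSeries.C e * t * Q * w +
    PowerSeries.C γ * cg * Q * w - PowerSeries.C γ * cg * PowerSeries.C e * t * Q * w -
    PowerSeries.C γ * E * g1 * Q * w

end NormallyOrdered

/-! ### Additive maps commuting with `t` -/

section XAdditive

variable {A B : Type*} [Ring A] [Ring B]

/-- A map of power series modules is additive and commutes with the multiplication by `t`. Such a
map is determined by its values on constants. -/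
structure XAdditive (f : A⟦X⟧ → B⟦X⟧) : Prop where
  apply_add : ∀ x y, f (x + y) = f x + f y
  apply_X_mul : ∀ x, f (PowerSeries.X * x) = PowerSeries.X * f x

theorem mul_X_mul (x y : A⟦X⟧) : x * (PowerSeries.X * y) = PowerSeries.X * (x * y) := by
  rw [← mul_assoc, ← X_mul_comm, mul_assoc]

theorem XAdditive.eq_of_C {f g : A⟦X⟧ → B⟦X⟧} (hf : XAdditive f) (hg : XAdditive g)
    (h : ∀ a, f (PowerSeries.C a) = g (PowerSeries.C a)) (x : A⟦X⟧) : f x = g x := by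
  ext n
  induction n generalizing x with
  | zero =>
    rw [x.eq_X_mul_shift_add_const, hf.apply_add, hg.apply_add, hf.apply_X_mul, hg.apply_X_mul, h]
    simp
  | succ n ih =>
    rw [x.eq_X_mul_shift_add_const, hf.apply_add, hg.apply_add, hf.apply_X_mul, hg.apply_X_mul, h,
      map_add, map_add, PowerSeries.coeff_succ_X_mul, PowerSeries.coeff_succ_X_mul, ih]

/-- On power series over a tensor product, the values on constant pure tensors suffice. -/
theorem XAdditive.eq_of_C_tmul {k A' : Type*} [CommRing k] [Ring A'] [Algebra k A] [Algebra k A']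
    {f g : (A ⊗[k] A')⟦X⟧ → B⟦X⟧} (hf : XAdditive f) (hg : XAdditive g)
    (h : ∀ (a : A) (a' : A'), f (PowerSeries.C (a ⊗ₜ[k] a')) = g (PowerSeries.C (a ⊗ₜ[k] a')))
    (x : (A ⊗[k] A')⟦X⟧) : f x = g x := by
  refine hf.eq_of_C hg (fun z => ?_) x
  induction z with
  | zero => rw [← TensorProduct.tmul_zero A' (0 : A), h]
  | tmul a a' => exact h a a'
  | add y z hy hz => rw [map_add, hf.apply_add, hg.apply_add, hy, hz]

theorem XAdditive.id : XAdditive (fun x : A⟦X⟧ => x) := ⟨fun _ _ => rfl, fun _ => rfl⟩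

theorem XAdditive.mul_left {f : A⟦X⟧ → B⟦X⟧} (hf : XAdditive f) (u : B⟦X⟧) :
    XAdditive fun x => u * f x :=
  ⟨fun x y => by rw [hf.apply_add, mul_add], fun x => by rw [hf.apply_X_mul, mul_X_mul]⟩

theorem XAdditive.mul_right {f : A⟦X⟧ → B⟦X⟧} (hf : XAdditive f) (u : B⟦X⟧) :
    XAdditive fun x => f x * u :=
  ⟨fun x y => by rw [hf.apply_add, add_mul], fun x => by rw [hf.apply_X_mul, mul_assoc]⟩

theorem XAdditive.comp {D : Type*} [Ring D] {f : B⟦X⟧ → D⟦X⟧} {g : A⟦X⟧ → B⟦X⟧}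
    (hf : XAdditive f) (hg : XAdditive g) : XAdditive fun x => f (g x) :=
  ⟨fun x y => by rw [hg.apply_add, hf.apply_add], fun x => by rw [hg.apply_X_mul, hf.apply_X_mul]⟩

end XAdditive

section Extensions

variable {k A A' B B' D : Type*} [CommRing k] [Ring A] [Ring A'] [Ring B] [Ring B'] [Ring D]
variable [Algebra k A] [Algebra k A'] [Algebra k B] [Algebra k B'] [Algebra k D]

theorem coeff_mapLin (φ : A →ₗ[k] B) (x : A⟦X⟧) (n : ℕ) :
    PowerSeries.coeff n (mapLin k φ x) = φ (PowerSeries.coeff n x) := by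
  simp [mapLin]

theorem mapLin_C (φ : A →ₗ[k] B) (a : A) :
    mapLin k φ (PowerSeries.C a) = PowerSeries.C (φ a) := by
  ext n
  rw [coeff_mapLin, PowerSeries.coeff_C, PowerSeries.coeff_C]
  split_ifs <;> simp

theorem xAdditive_mapLin (φ : A →ₗ[k] B) : XAdditive (mapLin k φ) :=
  ⟨map_add _, fun x => by
    ext n
    rcases n with _ | n
    · simp [coeff_mapLin]
    · rw [coeff_mapLin, PowerSeries.coeff_succ_X_mul, PowerSeries.coeff_succ_X_mul, coeff_mapLin]⟩

theorem mapAlgHom_eq_mapLin (φ : A →ₐ[k] B) (x : A⟦X⟧) :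
    PowerSeries.mapAlgHom φ x = mapLin k φ.toLinearMap x := by
  ext n
  rw [coeff_mapLin, PowerSeries.mapAlgHom_apply, PowerSeries.coeff_map]
  rfl

@[simp] theorem mapAlgHom_C (φ : A →ₐ[k] B) (a : A) :
    PowerSeries.mapAlgHom φ (PowerSeries.C a) = PowerSeries.C (φ a) := by
  rw [mapAlgHom_eq_mapLin, mapLin_C]; rfl

theorem xAdditive_mapAlgHom (φ : A →ₐ[k] B) : XAdditive (PowerSeries.mapAlgHom φ) := by
  have : ⇑(PowerSeries.mapAlgHom φ) = mapLin k φ.toLinearMap := funext (mapAlgHom_eq_mapLin φ)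
  rw [this]
  exact xAdditive_mapLin _

theorem xAdditive_extend (φ : A →ₗ[k] B⟦X⟧) : XAdditive (extend k φ) :=
  ⟨map_add _, fun x => by
    ext n
    rcases n with _ | n
    · simp [extend]
    · rw [PowerSeries.coeff_succ_X_mul]
      simp [extend, Finset.Nat.antidiagonal_succ]⟩

theorem extend_C (φ : A →ₗ[k] B⟦X⟧) (a : A) : extend k φ (PowerSeries.C a) = φ a := by
  ext n
  simp only [extend, LinearMap.coe_mk, AddHom.coe_mk, PowerSeries.coeff_mk]
  rw [Finset.sum_eq_single (0, n)]
  · simp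
  · intro ij hij hne
    have h1 : ij.1 ≠ 0 := fun h => hne (Prod.ext h (by
      have := Finset.HasAntidiagonal.mem_antidiagonal.mp hij
      simpa [h] using this))
    simp [PowerSeries.coeff_C, h1]
  · simp

theorem xAdditive_tensorMap (f : A⟦X⟧ →ₗ[k] B⟦X⟧) (g : A'⟦X⟧ →ₗ[k] B'⟦X⟧) :
    XAdditive (tensorMap k f g) := xAdditive_extend _

theorem tensorMap_C_tmul (f : A⟦X⟧ →ₗ[k] B⟦X⟧) (g : A'⟦X⟧ →ₗ[k] B'⟦X⟧) (a : A) (a' : A') :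
    tensorMap k f g (PowerSeries.C (a ⊗ₜ[k] a')) =
      tmul k (f (PowerSeries.C a)) (g (PowerSeries.C a')) := by
  rw [tensorMap, extend_C]; rfl

theorem tmul_eq (x : A⟦X⟧) (y : B⟦X⟧) : tmul k x y =
    PowerSeries.mapAlgHom (Algebra.TensorProduct.includeLeft : A →ₐ[k] A ⊗[k] B) x *
      PowerSeries.mapAlgHom (Algebra.TensorProduct.includeRight : B →ₐ[k] A ⊗[k] B) y := rfl

theorem mapLin_mul'_tmul (x y : A⟦X⟧) : mapLin k (LinearMap.mul' k A) (tmul k x y) = x * y := by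
  ext n
  simp [coeff_mapLin, coeff_tmul, PowerSeries.coeff_mul]

theorem scalar_mul_comm (c : k⟦X⟧) (x : A⟦X⟧) : scalar k A c * x = x * scalar k A c := by
  refine (commute_of_coeff fun i j => ?_).eq
  simp only [scalar, PowerSeries.coeff_map]
  exact Algebra.commutes _ _

/-- If `f` is linear on constants then it is linear over the power series in the ground ring. -/
theorem XAdditive.map_scalar_mul {f : A⟦X⟧ → B⟦X⟧} (hf : XAdditive f)
    (hs : ∀ (c : k) (a : A), f (PowerSeries.C (c • a)) =
      PowerSeries.C (algebraMap k B c) * f (PowerSeries.C a)) (c : k⟦X⟧) (x : A⟦X⟧) :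
    f (scalar k A c * x) = scalar k B c * f x := by
  have h1 : XAdditive fun c : k⟦X⟧ => f (scalar k A c * x) :=
    ⟨fun c d => by rw [map_add, add_mul, hf.apply_add], fun c => by
      rw [map_mul, scalar, PowerSeries.map_X, mul_assoc, hf.apply_X_mul]⟩
  have h2 : XAdditive fun c : k⟦X⟧ => scalar k B c * f x :=
    ⟨fun c d => by rw [map_add, add_mul], fun c => by
      rw [map_mul, scalar, PowerSeries.map_X, mul_assoc]⟩
  refine h1.eq_of_C h2 (fun c => ?_) c
  refine (hf.comp (XAdditive.id.mul_left _)).eq_of_C (hf.mul_left _) (fun a => ?_) x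
  simp only [scalar, PowerSeries.map_C]
  rw [← map_mul, ← Algebra.smul_def, hs]

end Extensions

/-! ### Coefficientwise bilinear operations -/

section Convolve

variable {k A B D : Type*} [CommRing k] [Ring A] [Ring B] [Ring D]
variable [Algebra k A] [Algebra k B] [Algebra k D]

/-- The `t`-bilinear extension of a bilinear map to power series. -/
def convolve (φ : A →ₗ[k] B →ₗ[k] D) (x : A⟦X⟧) (y : B⟦X⟧) : D⟦X⟧ :=
  mapLin k (TensorProduct.lift φ) (tmul k x y)

theorem xAdditive_tmul_right (x : A⟦X⟧) : XAdditive fun y : B⟦X⟧ => tmul k x y := by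
  simp only [tmul_eq]
  exact (xAdditive_mapAlgHom _).mul_left _

theorem xAdditive_tmul_left (y : B⟦X⟧) : XAdditive fun x : A⟦X⟧ => tmul k x y := by
  simp only [tmul_eq]
  exact (xAdditive_mapAlgHom _).mul_right _

theorem xAdditive_convolve_right (φ : A →ₗ[k] B →ₗ[k] D) (x : A⟦X⟧) :
    XAdditive (convolve φ x) :=
  (xAdditive_mapLin _).comp (xAdditive_tmul_right x)

theorem xAdditive_convolve_left (φ : A →ₗ[k] B →ₗ[k] D) (y : B⟦X⟧) :
    XAdditive fun x => convolve φ x y :=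
  (xAdditive_mapLin _).comp (xAdditive_tmul_left y)

theorem convolve_C_C (φ : A →ₗ[k] B →ₗ[k] D) (a : A) (b : B) :
    convolve φ (PowerSeries.C a) (PowerSeries.C b) = PowerSeries.C (φ a b) := by
  rw [convolve, tmul_eq, mapAlgHom_C, mapAlgHom_C, C_mul_C, mapLin_C]
  simp

theorem convolve_C_left (φ : A →ₗ[k] B →ₗ[k] D) (a : A) (y : B⟦X⟧) :
    convolve φ (PowerSeries.C a) y = mapLin k (φ a) y :=
  (xAdditive_convolve_right φ _).eq_of_C (xAdditive_mapLin _)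
    (fun b => by rw [convolve_C_C, mapLin_C]) y

theorem convolve_C_right (φ : A →ₗ[k] B →ₗ[k] D) (x : A⟦X⟧) (b : B) :
    convolve φ x (PowerSeries.C b) = mapLin k (φ.flip b) x :=
  (xAdditive_convolve_left φ _).eq_of_C (xAdditive_mapLin _)
    (fun a => by rw [convolve_C_C, mapLin_C, LinearMap.flip_apply]) x

/-- A multiplicative action extends to a multiplicative action. -/
theorem convolve_mul {φ : A →ₗ[k] B →ₗ[k] B} (h : ∀ a a' b, φ (a * a') b = φ a (φ a' b))
    (x x' : A⟦X⟧) (y : B⟦X⟧) : convolve φ (x * x') y = convolve φ x (convolve φ x' y) := by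
  refine ((xAdditive_convolve_left φ y).comp (XAdditive.id.mul_right x')).eq_of_C
    (xAdditive_convolve_left φ _) (fun a => ?_) x
  refine ((xAdditive_convolve_left φ y).comp (XAdditive.id.mul_left _)).eq_of_C
    ((xAdditive_convolve_right φ _).comp (xAdditive_convolve_left φ _)) (fun a' => ?_) x'
  refine (xAdditive_convolve_right φ _).eq_of_C
    ((xAdditive_convolve_right φ _).comp (xAdditive_convolve_right φ _)) (fun b => ?_) y
  rw [C_mul_C, convolve_C_C, convolve_C_C, convolve_C_C, h]

/-- An antimultiplicative action extends to an antimultiplicative action. -/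
theorem convolve_mul' {φ : A →ₗ[k] B →ₗ[k] B} (h : ∀ a a' b, φ (a * a') b = φ a' (φ a b))
    (x x' : A⟦X⟧) (y : B⟦X⟧) : convolve φ (x * x') y = convolve φ x' (convolve φ x y) := by
  refine ((xAdditive_convolve_left φ y).comp (XAdditive.id.mul_right x')).eq_of_C
    ((xAdditive_convolve_right φ _).comp (xAdditive_convolve_left φ _)) (fun a => ?_) x
  refine ((xAdditive_convolve_left φ y).comp (XAdditive.id.mul_left _)).eq_of_C
    (xAdditive_convolve_left φ _) (fun a' => ?_) x'
  refine (xAdditive_convolve_right φ _).eq_of_C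
    ((xAdditive_convolve_right φ _).comp (xAdditive_convolve_right φ _)) (fun b => ?_) y
  rw [C_mul_C, convolve_C_C, convolve_C_C, convolve_C_C, h]

end Convolve

/-! ### Twisting a Hopf algebra -/

/-- Conjugation by a unit, as an algebra homomorphism. -/
def conjHom (k : Type*) {R : Type*} [CommRing k] [Ring R] [Algebra k R] (u : Rˣ) : R →ₐ[k] R :=
  AlgHom.ofLinearMap ((LinearMap.mulLeft k u.val) ∘ₗ (LinearMap.mulRight k u⁻¹.val))
    (by simp) (fun x y => by simp [mul_assoc])

theorem conjHom_apply {k R : Type*} [CommRing k] [Ring R] [Algebra k R] (u : Rˣ) (x : R) :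
    conjHom k u x = u.val * x * u⁻¹.val := by simp [conjHom, mul_assoc]

theorem inv_mul_inv_eq {R : Type*} [Monoid R] {a a' b b' c c' d d' : R} (h : a * b = c * d)
    (ha : a' * a = 1) (hb : b' * b = 1) (hc : c * c' = 1) (hd : d * d' = 1) :
    b' * a' = d' * c' := by
  refine left_inv_eq_right_inv (a := a * b) ?_ ?_
  · rw [mul_assoc, ← mul_assoc a', ha, one_mul, hb]
  · rw [h, mul_assoc, ← mul_assoc d, hd, one_mul, hc]

section Twisting

variable {k A : Type*} [CommRing k] [Ring A] [HopfAlgebra k A]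

/-- The twisted coproduct `x ↦ 𝓕 Δ₀(x) 𝓕⁻¹`. -/
def twistComul (𝓕 : ((A ⊗[k] A)⟦X⟧)ˣ) : A⟦X⟧ →ₐ[k] (A ⊗[k] A)⟦X⟧ :=
  (conjHom k 𝓕).comp (PowerSeries.mapAlgHom (Bialgebra.comulAlgHom k A))

theorem twistComul_apply (𝓕 : ((A ⊗[k] A)⟦X⟧)ˣ) (x : A⟦X⟧) : twistComul 𝓕 x =
    𝓕.val * PowerSeries.mapAlgHom (Bialgebra.comulAlgHom k A) x * 𝓕⁻¹.val :=
  conjHom_apply _ _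

/-- The twisted antipode `x ↦ w S₀(x) w⁻¹`. -/
def twistAntipode (w : (A⟦X⟧)ˣ) : A⟦X⟧ →ₗ[k] A⟦X⟧ :=
  (conjHom k w).toLinearMap ∘ₗ mapLin k (HopfAlgebra.antipode k (A := A))

theorem twistAntipode_apply (w : (A⟦X⟧)ˣ) (x : A⟦X⟧) : twistAntipode (k := k) w x =
    w.val * mapLin k (HopfAlgebra.antipode k (A := A)) x * w⁻¹.val :=
  conjHom_apply _ _

theorem xAdditive_twistAntipode (w : (A⟦X⟧)ˣ) : XAdditive (twistAntipode (k := k) w) := by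
  have : ⇑(twistAntipode (k := k) w) = _ := funext (twistAntipode_apply w)
  rw [this]
  exact ((xAdditive_mapLin _).mul_left _).mul_right _

/-! ### Coassociativity and the counit -/

/-- The placement `𝓕 ⊗ 1` of an element of the tensor square in the tensor cube. -/
abbrev place₁₂ : (A ⊗[k] A)⟦X⟧ →ₐ[k] ((A ⊗[k] A) ⊗[k] A)⟦X⟧ :=
  PowerSeries.mapAlgHom Algebra.TensorProduct.includeLeft

/-- The placement `1 ⊗ 𝓕` of an element of the tensor square in the tensor cube. -/
abbrev place₂₃ : (A ⊗[k] A)⟦X⟧ →ₐ[k] (A ⊗[k] (A ⊗[k] A))⟦X⟧ :=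
  PowerSeries.mapAlgHom Algebra.TensorProduct.includeRight

/-- The coefficientwise map `Δ₀ ⊗ id`. -/
abbrev comulLeft : (A ⊗[k] A)⟦X⟧ →ₐ[k] ((A ⊗[k] A) ⊗[k] A)⟦X⟧ :=
  PowerSeries.mapAlgHom
    (Algebra.TensorProduct.map (Bialgebra.comulAlgHom k A) (AlgHom.id k A))

/-- The coefficientwise map `id ⊗ Δ₀`. -/
abbrev comulRight : (A ⊗[k] A)⟦X⟧ →ₐ[k] (A ⊗[k] (A ⊗[k] A))⟦X⟧ :=
  PowerSeries.mapAlgHom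
    (Algebra.TensorProduct.map (AlgHom.id k A) (Bialgebra.comulAlgHom k A))

/-- The coefficientwise associator. -/
abbrev assocHom : ((A ⊗[k] A) ⊗[k] A)⟦X⟧ →ₐ[k] (A ⊗[k] (A ⊗[k] A))⟦X⟧ :=
  PowerSeries.mapAlgHom (Algebra.TensorProduct.assoc k k k A A A).toAlgHom

/-- `Δ ⊗ id` is the conjugate of `Δ₀ ⊗ id` by `𝓕 ⊗ 1`. -/
theorem tensorMap_twistComul_id (𝓕 : ((A ⊗[k] A)⟦X⟧)ˣ) (z : (A ⊗[k] A)⟦X⟧) :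
    tensorMap k (twistComul 𝓕).toLinearMap LinearMap.id z =
      place₁₂ 𝓕.val * comulLeft z * place₁₂ 𝓕⁻¹.val := by
  refine (xAdditive_tensorMap _ _).eq_of_C_tmul
    (((xAdditive_mapAlgHom _).mul_left _).mul_right _) (fun a a' => ?_) z
  rw [tensorMap_C_tmul, AlgHom.toLinearMap_apply, twistComul_apply, tmul_eq, map_mul, map_mul,
    LinearMap.id_apply, mapAlgHom_C, mapAlgHom_C, mapAlgHom_C, mapAlgHom_C]
  have hc : Commute (PowerSeries.mapAlgHom
      (Algebra.TensorProduct.includeLeft : A ⊗[k] A →ₐ[k] (A ⊗[k] A) ⊗[k] A) 𝓕⁻¹.val)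
      (PowerSeries.C ((Algebra.TensorProduct.includeRight :
        A →ₐ[k] (A ⊗[k] A) ⊗[k] A) a')) := by
    ext n
    rw [PowerSeries.coeff_mul_C, PowerSeries.coeff_C_mul, PowerSeries.mapAlgHom_apply,
      PowerSeries.coeff_map]
    simp
  rw [mul_assoc, hc.eq, ← mul_assoc, mul_assoc (PowerSeries.mapAlgHom _ _), C_mul_C]
  congr 3
  simp

/-- `id ⊗ Δ` is the conjugate of `id ⊗ Δ₀` by `1 ⊗ 𝓕`. -/
theorem tensorMap_id_twistComul (𝓕 : ((A ⊗[k] A)⟦X⟧)ˣ) (z : (A ⊗[k] A)⟦X⟧) :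
    tensorMap k LinearMap.id (twistComul 𝓕).toLinearMap z =
      place₂₃ 𝓕.val * comulRight z * place₂₃ 𝓕⁻¹.val := by
  refine (xAdditive_tensorMap _ _).eq_of_C_tmul
    (((xAdditive_mapAlgHom _).mul_left _).mul_right _) (fun a a' => ?_) z
  rw [tensorMap_C_tmul, AlgHom.toLinearMap_apply, twistComul_apply, tmul_eq, map_mul, map_mul,
    LinearMap.id_apply, mapAlgHom_C, mapAlgHom_C, mapAlgHom_C, mapAlgHom_C]
  have hc : Commute (PowerSeries.C ((Algebra.TensorProduct.includeLeft :
        A →ₐ[k] A ⊗[k] (A ⊗[k] A)) a)) (PowerSeries.mapAlgHom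
      (Algebra.TensorProduct.includeRight : A ⊗[k] A →ₐ[k] A ⊗[k] (A ⊗[k] A)) 𝓕.val) := by
    ext n
    rw [PowerSeries.coeff_mul_C, PowerSeries.coeff_C_mul, PowerSeries.mapAlgHom_apply,
      PowerSeries.coeff_map]
    simp
  rw [← mul_assoc, ← mul_assoc, hc.eq, mul_assoc (PowerSeries.mapAlgHom _ _), C_mul_C]
  congr 3
  simp

theorem assocHom_comulLeft_comul (x : A⟦X⟧) :
    assocHom (comulLeft (PowerSeries.mapAlgHom (Bialgebra.comulAlgHom k A) x)) =
      comulRight (PowerSeries.mapAlgHom (Bialgebra.comulAlgHom k A) x) := by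
  refine ((xAdditive_mapAlgHom _).comp ((xAdditive_mapAlgHom _).comp
    (xAdditive_mapAlgHom _))).eq_of_C ((xAdditive_mapAlgHom _).comp (xAdditive_mapAlgHom _))
    (fun a => ?_) x
  simp only [mapAlgHom_C]
  congr 1
  exact Coalgebra.coassoc_apply a

/-- The two iterated coproducts of `x` are the conjugates of the iterated `Δ₀(x)` by the two sides
of the cocycle condition. -/
theorem twistComul_coassoc {𝓕 : ((A ⊗[k] A)⟦X⟧)ˣ} (h𝓕 : IsDrinfeldTwist 𝓕) (x : A⟦X⟧) :
    mapLin k (TensorProduct.assoc k A A A).toLinearMap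
        (tensorMap k (twistComul 𝓕).toLinearMap LinearMap.id (twistComul 𝓕 x)) =
      tensorMap k LinearMap.id (twistComul 𝓕).toLinearMap (twistComul 𝓕 x) := by
  have ha : ∀ z, mapLin k (TensorProduct.assoc k A A A).toLinearMap z = assocHom z :=
    fun z => by rw [mapAlgHom_eq_mapLin]; rfl
  have hc : assocHom (place₁₂ 𝓕.val) * assocHom (comulLeft 𝓕.val) =
      place₂₃ 𝓕.val * comulRight 𝓕.val := by
    rw [← map_mul]; exact h𝓕.cocycle
  have hc' : assocHom (comulLeft 𝓕⁻¹.val) * assocHom (place₁₂ 𝓕⁻¹.val) =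
      comulRight 𝓕⁻¹.val * place₂₃ 𝓕⁻¹.val := by
    exact inv_mul_inv_eq hc (by simp [← map_mul]) (by simp [← map_mul]) (by simp [← map_mul])
      (by simp [← map_mul])
  rw [ha, tensorMap_twistComul_id, tensorMap_id_twistComul, twistComul_apply]
  simp only [map_mul]
  rw [assocHom_comulLeft_comul, ← mul_assoc, ← mul_assoc, hc, mul_assoc, hc']
  simp only [mul_assoc]

variable (k A) in
/-- The algebra homomorphism `ε ⊗ id`. -/
def counitLeft : A ⊗[k] A →ₐ[k] A :=
  (Algebra.TensorProduct.lid k A).toAlgHom.comp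
    (Algebra.TensorProduct.map (Bialgebra.counitAlgHom k A) (AlgHom.id k A))

variable (k A) in
/-- The algebra homomorphism `id ⊗ ε`. -/
def counitRight : A ⊗[k] A →ₐ[k] A :=
  (Algebra.TensorProduct.rid k k A).toAlgHom.comp
    (Algebra.TensorProduct.map (AlgHom.id k A) (Bialgebra.counitAlgHom k A))

theorem counitLeft_toLinearMap : (counitLeft k A).toLinearMap =
    (TensorProduct.lid k A).toLinearMap ∘ₗ Coalgebra.counit.rTensor A :=
  TensorProduct.ext' fun a b => by simp [counitLeft]

theorem counitRight_toLinearMap : (counitRight k A).toLinearMap =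
    (TensorProduct.rid k A).toLinearMap ∘ₗ Coalgebra.counit.lTensor A :=
  TensorProduct.ext' fun a b => by simp [counitRight]

theorem IsDrinfeldTwist.counitLeft_eq {𝓕 : ((A ⊗[k] A)⟦X⟧)ˣ} (h𝓕 : IsDrinfeldTwist 𝓕) :
    PowerSeries.mapAlgHom (counitLeft k A) 𝓕.val = 1 := by
  rw [mapAlgHom_eq_mapLin, counitLeft_toLinearMap, h𝓕.counit_left]

theorem IsDrinfeldTwist.counitRight_eq {𝓕 : ((A ⊗[k] A)⟦X⟧)ˣ} (h𝓕 : IsDrinfeldTwist 𝓕) :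
    PowerSeries.mapAlgHom (counitRight k A) 𝓕.val = 1 := by
  rw [mapAlgHom_eq_mapLin, counitRight_toLinearMap, h𝓕.counit_right]

theorem algHom_inv_eq_one {R S : Type*} [Ring R] [Ring S] [Algebra k R] [Algebra k S]
    (φ : R →ₐ[k] S) {u : Rˣ} (h : φ u.val = 1) : φ u⁻¹.val = 1 := by
  have : φ (u.val * u⁻¹.val) = 1 := by rw [u.mul_inv, map_one]
  rwa [map_mul, h, one_mul] at this

theorem counit_twistComul {𝓕 : ((A ⊗[k] A)⟦X⟧)ˣ} (h𝓕 : IsDrinfeldTwist 𝓕) (x : A⟦X⟧) :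
    mapLin k (TensorProduct.lid k A).toLinearMap
      (tensorMap k (PowerSeries.mapAlgHom (Bialgebra.counitAlgHom k A)).toLinearMap
        LinearMap.id (twistComul 𝓕 x)) = x := by
  have h1 : ∀ z, mapLin k (TensorProduct.lid k A).toLinearMap
      (tensorMap k (PowerSeries.mapAlgHom (Bialgebra.counitAlgHom k A)).toLinearMap
        LinearMap.id z) = PowerSeries.mapAlgHom (counitLeft k A) z := by
    refine ((xAdditive_mapLin _).comp (xAdditive_tensorMap _ _)).eq_of_C_tmul
      (xAdditive_mapAlgHom _) (fun a a' => ?_)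
    rw [tensorMap_C_tmul, AlgHom.toLinearMap_apply, mapAlgHom_C, mapAlgHom_C, LinearMap.id_apply,
      tmul_eq, mapAlgHom_C, mapAlgHom_C, C_mul_C, mapLin_C]
    simp [counitLeft]
  have h2 : ∀ x, PowerSeries.mapAlgHom (counitLeft k A)
      (PowerSeries.mapAlgHom (Bialgebra.comulAlgHom k A) x) = x := by
    refine ((xAdditive_mapAlgHom _).comp (xAdditive_mapAlgHom _)).eq_of_C XAdditive.id
      (fun a => ?_)
    rw [mapAlgHom_C, mapAlgHom_C]
    congr 1
    rw [← AlgHom.toLinearMap_apply, counitLeft_toLinearMap]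
    simp
  rw [h1, twistComul_apply, map_mul, map_mul, h2, h𝓕.counitLeft_eq,
    algHom_inv_eq_one _ h𝓕.counitLeft_eq, one_mul, mul_one]

theorem twistComul_counit {𝓕 : ((A ⊗[k] A)⟦X⟧)ˣ} (h𝓕 : IsDrinfeldTwist 𝓕) (x : A⟦X⟧) :
    mapLin k (TensorProduct.rid k A).toLinearMap
      (tensorMap k LinearMap.id
        (PowerSeries.mapAlgHom (Bialgebra.counitAlgHom k A)).toLinearMap (twistComul 𝓕 x)) = x := by
  have h1 : ∀ z, mapLin k (TensorProduct.rid k A).toLinearMap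
      (tensorMap k LinearMap.id
        (PowerSeries.mapAlgHom (Bialgebra.counitAlgHom k A)).toLinearMap z) =
      PowerSeries.mapAlgHom (counitRight k A) z := by
    refine ((xAdditive_mapLin _).comp (xAdditive_tensorMap _ _)).eq_of_C_tmul
      (xAdditive_mapAlgHom _) (fun a a' => ?_)
    rw [tensorMap_C_tmul, AlgHom.toLinearMap_apply, mapAlgHom_C, mapAlgHom_C, LinearMap.id_apply,
      tmul_eq, mapAlgHom_C, mapAlgHom_C, C_mul_C, mapLin_C]
    simp [counitRight]
  have h2 : ∀ x, PowerSeries.mapAlgHom (counitRight k A)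
      (PowerSeries.mapAlgHom (Bialgebra.comulAlgHom k A) x) = x := by
    refine ((xAdditive_mapAlgHom _).comp (xAdditive_mapAlgHom _)).eq_of_C XAdditive.id
      (fun a => ?_)
    rw [mapAlgHom_C, mapAlgHom_C]
    congr 1
    rw [← AlgHom.toLinearMap_apply, counitRight_toLinearMap]
    simp
  rw [h1, twistComul_apply, map_mul, map_mul, h2, h𝓕.counitRight_eq,
    algHom_inv_eq_one _ h𝓕.counitRight_eq, one_mul, mul_one]

/-! ### The antipode -/

/-- The bilinear map `(a ⊗ b, u) ↦ f(a) u g(b)`. -/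
def sandwich (f g : A →ₗ[k] A) : A ⊗[k] A →ₗ[k] A →ₗ[k] A :=
  TensorProduct.lift (LinearMap.mk₂ k
    (fun a b => LinearMap.mulLeft k (f a) ∘ₗ LinearMap.mulRight k (g b))
    (fun a a' b => by ext u; simp [add_mul]) (fun c a b => by ext u; simp)
    (fun a b b' => by ext u; simp [mul_add]) (fun c a b => by ext u; simp))

@[simp] theorem sandwich_tmul (f g : A →ₗ[k] A) (a b u : A) :
    sandwich f g (a ⊗ₜ[k] b) u = f a * u * g b := by
  simp [sandwich, mul_assoc]

theorem sandwich_mul {f g : A →ₗ[k] A} (hf : ∀ a a', f (a * a') = f a * f a')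
    (hg : ∀ a a', g (a * a') = g a' * g a) (z z' : A ⊗[k] A) (u : A) :
    sandwich f g (z * z') u = sandwich f g z (sandwich f g z' u) := by
  induction z with
  | zero => simp
  | add x y hx hy => simp only [add_mul, map_add, LinearMap.add_apply, hx, hy]
  | tmul a b =>
    induction z' with
    | zero => simp
    | add x y hx hy => simp only [mul_add, map_add, LinearMap.add_apply, hx, hy]
    | tmul a' b' => simp [hf, hg, mul_assoc]

theorem sandwich_mul' {f g : A →ₗ[k] A} (hf : ∀ a a', f (a * a') = f a' * f a)
    (hg : ∀ a a', g (a * a') = g a * g a') (z z' : A ⊗[k] A) (u : A) :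
    sandwich f g (z * z') u = sandwich f g z' (sandwich f g z u) := by
  induction z with
  | zero => simp
  | add x y hx hy => simp only [add_mul, map_add, LinearMap.add_apply, hx, hy]
  | tmul a b =>
    induction z' with
    | zero => simp
    | add x y hx hy => simp only [mul_add, map_add, LinearMap.add_apply, hx, hy]
    | tmul a' b' => simp [hf, hg, mul_assoc]

theorem mapLin_mul_mul (a b : A) (u : A⟦X⟧) :
    mapLin k (LinearMap.mulLeft k a ∘ₗ LinearMap.mulRight k b) u =
      PowerSeries.C a * u * PowerSeries.C b := by
  ext n
  simp [coeff_mapLin, mul_assoc]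

theorem convolve_sandwich_tmul (f g : A →ₗ[k] A) (a b : A) (u : A⟦X⟧) :
    convolve (sandwich f g) (PowerSeries.C (a ⊗ₜ[k] b)) u =
      PowerSeries.C (f a) * u * PowerSeries.C (g b) := by
  rw [convolve_C_left, ← mapLin_mul_mul (k := k)]
  congr 2

theorem convolve_sandwich_scalar_mul (f g : A →ₗ[k] A) (z : (A ⊗[k] A)⟦X⟧) (c : k⟦X⟧)
    (u : A⟦X⟧) : convolve (sandwich f g) z (scalar k A c * u) =
      scalar k A c * convolve (sandwich f g) z u := by
  refine (xAdditive_convolve_right _ z).map_scalar_mul (fun c a => ?_) c u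
  rw [convolve_C_right, convolve_C_right, map_smul]
  ext n
  simp [coeff_mapLin, Algebra.smul_def]

variable (k A) in
/-- The action `(a ⊗ b, u) ↦ S₀(a) u b`. -/
abbrev antipodeSandwich : A ⊗[k] A →ₗ[k] A →ₗ[k] A :=
  sandwich (HopfAlgebra.antipode k) LinearMap.id

variable (k A) in
/-- The action `(a ⊗ b, u) ↦ a u S₀(b)`. -/
abbrev sandwichAntipode : A ⊗[k] A →ₗ[k] A →ₗ[k] A :=
  sandwich LinearMap.id (HopfAlgebra.antipode k)

theorem antipodeSandwich_one (z : A ⊗[k] A) : antipodeSandwich k A z 1 =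
    LinearMap.mul' k A ((HopfAlgebra.antipode k).rTensor A z) := by
  induction z with
  | zero => simp
  | add x y hx hy => simp only [map_add, LinearMap.add_apply, hx, hy]
  | tmul a b => simp

theorem sandwichAntipode_one (z : A ⊗[k] A) : sandwichAntipode k A z 1 =
    LinearMap.mul' k A ((HopfAlgebra.antipode k).lTensor A z) := by
  induction z with
  | zero => simp
  | add x y hx hy => simp only [map_add, LinearMap.add_apply, hx, hy]
  | tmul a b => simp

theorem antipodeSandwich_comul (a : A) :
    antipodeSandwich k A (Coalgebra.comul a) 1 = algebraMap k A (Coalgebra.counit a) := by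
  rw [antipodeSandwich_one, HopfAlgebra.mul_antipode_rTensor_comul_apply]

theorem sandwichAntipode_comul (a : A) :
    sandwichAntipode k A (Coalgebra.comul a) 1 = algebraMap k A (Coalgebra.counit a) := by
  rw [sandwichAntipode_one, HopfAlgebra.mul_antipode_lTensor_comul_apply]

theorem convolve_antipodeSandwich_mul (z z' : (A ⊗[k] A)⟦X⟧) (u : A⟦X⟧) :
    convolve (antipodeSandwich k A) (z * z') u =
      convolve (antipodeSandwich k A) z' (convolve (antipodeSandwich k A) z u) :=
  convolve_mul' (sandwich_mul' HopfAlgebra.antipode_mul_antidistrib fun _ _ => rfl) z z' u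

theorem convolve_sandwichAntipode_mul (z z' : (A ⊗[k] A)⟦X⟧) (u : A⟦X⟧) :
    convolve (sandwichAntipode k A) (z * z') u =
      convolve (sandwichAntipode k A) z (convolve (sandwichAntipode k A) z' u) :=
  convolve_mul (sandwich_mul (fun _ _ => rfl) HopfAlgebra.antipode_mul_antidistrib) z z' u

theorem convolve_sandwich_one {f g : A →ₗ[k] A} (hf : f 1 = 1) (hg : g 1 = 1) (u : A⟦X⟧) :
    convolve (sandwich f g) 1 u = u := by
  rw [← map_one (PowerSeries.C (R := A ⊗[k] A)), Algebra.TensorProduct.one_def,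
    convolve_sandwich_tmul]
  simp [hf, hg]

theorem scalar_counit (x : A⟦X⟧) :
    scalar k A (PowerSeries.mapAlgHom (Bialgebra.counitAlgHom k A) x) =
      mapLin k (Algebra.linearMap k A ∘ₗ Coalgebra.counit) x := by
  ext n
  simp [scalar, coeff_mapLin, PowerSeries.mapAlgHom_apply]

theorem convolve_antipodeSandwich_comul (x : A⟦X⟧) :
    convolve (antipodeSandwich k A) (PowerSeries.mapAlgHom (Bialgebra.comulAlgHom k A) x) 1 =
      scalar k A (PowerSeries.mapAlgHom (Bialgebra.counitAlgHom k A) x) := by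
  rw [scalar_counit]
  refine ((xAdditive_convolve_left _ _).comp (xAdditive_mapAlgHom _)).eq_of_C
    (xAdditive_mapLin _) (fun a => ?_) x
  rw [← map_one PowerSeries.C, mapAlgHom_C, convolve_C_C, mapLin_C, Bialgebra.comulAlgHom_apply,
    antipodeSandwich_comul]
  rfl

theorem convolve_sandwichAntipode_comul (x : A⟦X⟧) :
    convolve (sandwichAntipode k A) (PowerSeries.mapAlgHom (Bialgebra.comulAlgHom k A) x) 1 =
      scalar k A (PowerSeries.mapAlgHom (Bialgebra.counitAlgHom k A) x) := by
  rw [scalar_counit]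
  refine ((xAdditive_convolve_left _ _).comp (xAdditive_mapAlgHom _)).eq_of_C
    (xAdditive_mapLin _) (fun a => ?_) x
  rw [← map_one PowerSeries.C, mapAlgHom_C, convolve_C_C, mapLin_C, Bialgebra.comulAlgHom_apply,
    sandwichAntipode_comul]
  rfl

theorem mapLin_eq_convolve_sandwichAntipode (z : (A ⊗[k] A)⟦X⟧) :
    mapLin k (LinearMap.mul' k A ∘ₗ (HopfAlgebra.antipode k (A := A)).lTensor A) z =
      convolve (sandwichAntipode k A) z 1 := by
  rw [← map_one PowerSeries.C, convolve_C_right]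
  exact congrArg (fun φ => mapLin k φ z) (LinearMap.ext fun z => (sandwichAntipode_one z).symm)

variable (k A) in
/-- The contraction `a ⊗ b ⊗ c ↦ a S₀(b) c`. -/
def contract : A ⊗[k] (A ⊗[k] A) →ₗ[k] A :=
  LinearMap.mul' k A ∘ₗ
    (LinearMap.mul' k A ∘ₗ (HopfAlgebra.antipode k (A := A)).rTensor A).lTensor A

/-- The contraction of `(1 ⊗ z) (z' ⊗ 1)` is `m(id ⊗ S₀)(z') m(S₀ ⊗ id)(z)`. -/
theorem contract_place (z z' : (A ⊗[k] A)⟦X⟧) :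
    mapLin k (contract k A) (place₂₃ z * assocHom (place₁₂ z')) =
      convolve (sandwichAntipode k A) z' 1 * convolve (antipodeSandwich k A) z 1 := by
  refine ((xAdditive_mapLin _).comp ((xAdditive_mapAlgHom _).mul_right _)).eq_of_C_tmul
    ((xAdditive_convolve_left _ _).mul_left _) (fun a b => ?_) z
  refine ((xAdditive_mapLin _).comp (((xAdditive_mapAlgHom _).comp
    (xAdditive_mapAlgHom _)).mul_left _)).eq_of_C_tmul
    ((xAdditive_convolve_left _ _).mul_right _) (fun a' b' => ?_) z'
  rw [mapAlgHom_C, mapAlgHom_C, mapAlgHom_C, C_mul_C, mapLin_C, convolve_sandwich_tmul,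
    convolve_sandwich_tmul, mul_one, mul_one, C_mul_C, C_mul_C, C_mul_C]
  simp [contract, HopfAlgebra.antipode_mul_antidistrib, mul_assoc]

/-- The contraction of `(a ⊗ T) (T' ⊗ b)` is `a m(id ⊗ S₀)(T') m(S₀ ⊗ id)(T) b`. -/
theorem contract_tmul_mul (a b : A) (T T' : A ⊗[k] A) :
    contract k A ((a ⊗ₜ[k] T) *
      (Algebra.TensorProduct.assoc k k k A A A).toAlgHom (T' ⊗ₜ[k] b)) =
      a * sandwichAntipode k A T' 1 * (antipodeSandwich k A T 1 * b) := by
  induction T with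
  | zero => simp
  | add x y hx hy =>
    simp only [TensorProduct.tmul_add, add_mul, mul_add, map_add, LinearMap.add_apply, hx, hy]
  | tmul x y =>
    induction T' with
    | zero => simp
    | add x y hx hy =>
      simp only [TensorProduct.add_tmul, add_mul, mul_add, map_add, LinearMap.add_apply, hx, hy]
    | tmul x' y' => simp [contract, HopfAlgebra.antipode_mul_antidistrib, mul_assoc]

/-- By the antipode axioms, the contraction of `(id ⊗ Δ₀)(z) (Δ₀ ⊗ id)(z')` is
`(id ⊗ ε)(z) (ε ⊗ id)(z')`. -/
theorem contract_comul (z z' : (A ⊗[k] A)⟦X⟧) :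
    mapLin k (contract k A) (comulRight z * assocHom (comulLeft z')) =
      PowerSeries.mapAlgHom (counitRight k A) z * PowerSeries.mapAlgHom (counitLeft k A) z' := by
  refine ((xAdditive_mapLin _).comp ((xAdditive_mapAlgHom _).mul_right _)).eq_of_C_tmul
    ((xAdditive_mapAlgHom _).mul_right _) (fun a b => ?_) z
  refine ((xAdditive_mapLin _).comp (((xAdditive_mapAlgHom _).comp
    (xAdditive_mapAlgHom _)).mul_left _)).eq_of_C_tmul
    ((xAdditive_mapAlgHom _).mul_left _) (fun a' b' => ?_) z'
  rw [mapAlgHom_C, mapAlgHom_C, mapAlgHom_C, mapAlgHom_C, mapAlgHom_C, C_mul_C, C_mul_C, mapLin_C,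
    Algebra.TensorProduct.map_tmul, Algebra.TensorProduct.map_tmul]
  congr 1
  erw [contract_tmul_mul]
  rw [Bialgebra.comulAlgHom_apply, Bialgebra.comulAlgHom_apply, sandwichAntipode_comul,
    antipodeSandwich_comul]
  have hl : counitLeft k A (a' ⊗ₜ[k] b') = algebraMap k A (Coalgebra.counit a') * b' := by
    simp [counitLeft, Algebra.smul_def]
  have hr : counitRight k A (a ⊗ₜ[k] b) = a * algebraMap k A (Coalgebra.counit b) := by
    simp [counitRight, Algebra.smul_def, Algebra.commutes]
  rw [hl, hr, AlgHom.id_apply, AlgHom.id_apply]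
  rw [mul_assoc, mul_assoc, ← mul_assoc (algebraMap k A _), Algebra.commutes, mul_assoc]

/-- The inverse of `w = m(id ⊗ S₀)(𝓕)` is `m(S₀ ⊗ id)(𝓕⁻¹)`. This is the contraction of the
cocycle condition in the form `(id ⊗ Δ₀)(𝓕) (Δ₀ ⊗ id)(𝓕)⁻¹ = (1 ⊗ 𝓕)⁻¹ (𝓕 ⊗ 1)`. -/
theorem IsDrinfeldTwist.mul_eq_one {𝓕 : ((A ⊗[k] A)⟦X⟧)ˣ} (h𝓕 : IsDrinfeldTwist 𝓕) :
    convolve (sandwichAntipode k A) 𝓕.val 1 * convolve (antipodeSandwich k A) 𝓕⁻¹.val 1 = 1 := by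
  have hc : assocHom (place₁₂ 𝓕.val) * assocHom (comulLeft 𝓕.val) =
      place₂₃ 𝓕.val * comulRight 𝓕.val := by
    rw [← map_mul]; exact h𝓕.cocycle
  have hc' : place₂₃ 𝓕⁻¹.val * assocHom (place₁₂ 𝓕.val) =
      comulRight 𝓕.val * assocHom (comulLeft 𝓕⁻¹.val) := by
    have h1 : place₂₃ 𝓕⁻¹.val * place₂₃ 𝓕.val = 1 := by simp [← map_mul]
    have h2 : assocHom (comulLeft 𝓕.val) * assocHom (comulLeft 𝓕⁻¹.val) = 1 := by
      simp [← map_mul]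
    calc place₂₃ 𝓕⁻¹.val * assocHom (place₁₂ 𝓕.val)
        = place₂₃ 𝓕⁻¹.val * (assocHom (place₁₂ 𝓕.val) * assocHom (comulLeft 𝓕.val)) *
            assocHom (comulLeft 𝓕⁻¹.val) := by rw [mul_assoc, mul_assoc, h2, mul_one]
      _ = _ := by rw [hc, ← mul_assoc, h1, one_mul]
  rw [← contract_place, hc', contract_comul, h𝓕.counitRight_eq,
    algHom_inv_eq_one _ h𝓕.counitLeft_eq, one_mul]

theorem mul'_tensorMap_twistAntipode_id (w : (A⟦X⟧)ˣ) (z : (A ⊗[k] A)⟦X⟧) :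
    mapLin k (LinearMap.mul' k A) (tensorMap k (twistAntipode w) LinearMap.id z) =
      w.val * convolve (antipodeSandwich k A) z w⁻¹.val := by
  refine ((xAdditive_mapLin _).comp (xAdditive_tensorMap _ _)).eq_of_C_tmul
    ((xAdditive_convolve_left _ _).mul_left _) (fun a b => ?_) z
  rw [tensorMap_C_tmul, mapLin_mul'_tmul, twistAntipode_apply, mapLin_C, convolve_sandwich_tmul]
  simp only [mul_assoc, LinearMap.id_apply]

theorem mul'_tensorMap_id_twistAntipode (w : (A⟦X⟧)ˣ) (z : (A ⊗[k] A)⟦X⟧) :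
    mapLin k (LinearMap.mul' k A) (tensorMap k LinearMap.id (twistAntipode w) z) =
      convolve (sandwichAntipode k A) z w.val * w⁻¹.val := by
  refine ((xAdditive_mapLin _).comp (xAdditive_tensorMap _ _)).eq_of_C_tmul
    ((xAdditive_convolve_left _ _).mul_right _) (fun a b => ?_) z
  rw [tensorMap_C_tmul, mapLin_mul'_tmul, twistAntipode_apply, mapLin_C, convolve_sandwich_tmul]
  simp only [mul_assoc, LinearMap.id_apply]

/-- As `S(a) b = w (S₀(a) w⁻¹ b)`, the claim follows by letting the factors of `𝓕 Δ₀(x) 𝓕⁻¹` act one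
after the other on `w⁻¹ = m(S₀ ⊗ id)(𝓕⁻¹)`. -/
theorem twistAntipode_left {𝓕 : ((A ⊗[k] A)⟦X⟧)ˣ} (h𝓕 : IsDrinfeldTwist 𝓕) {w : (A⟦X⟧)ˣ}
    (hw : w.val = convolve (sandwichAntipode k A) 𝓕.val 1) (x : A⟦X⟧) :
    mapLin k (LinearMap.mul' k A)
        (tensorMap k (twistAntipode w) LinearMap.id (twistComul 𝓕 x)) =
      scalar k A (PowerSeries.mapAlgHom (Bialgebra.counitAlgHom k A) x) := by
  have hv : convolve (antipodeSandwich k A) 𝓕⁻¹.val 1 = w⁻¹.val := by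
    have h := h𝓕.mul_eq_one
    rw [← hw] at h
    exact (Units.inv_eq_of_mul_eq_one_right h).symm
  have h1 : convolve (antipodeSandwich k A) 𝓕.val w⁻¹.val = 1 := by
    rw [← hv, ← convolve_antipodeSandwich_mul, 𝓕.inv_mul]
    exact convolve_sandwich_one HopfAlgebra.antipode_one rfl 1
  rw [mul'_tensorMap_twistAntipode_id, twistComul_apply, convolve_antipodeSandwich_mul,
    convolve_antipodeSandwich_mul, h1, convolve_antipodeSandwich_comul, ← mul_one (scalar k A _),
    convolve_sandwich_scalar_mul, hv, ← mul_assoc, ← scalar_mul_comm, mul_assoc, w.mul_inv]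

/-- As `a S(b) = (a w S₀(b)) w⁻¹`, the claim follows by letting the factors of `𝓕 Δ₀(x) 𝓕⁻¹` act one
after the other on `w = m(id ⊗ S₀)(𝓕)`. -/
theorem twistAntipode_right {𝓕 : ((A ⊗[k] A)⟦X⟧)ˣ} {w : (A⟦X⟧)ˣ}
    (hw : w.val = convolve (sandwichAntipode k A) 𝓕.val 1) (x : A⟦X⟧) :
    mapLin k (LinearMap.mul' k A)
        (tensorMap k LinearMap.id (twistAntipode w) (twistComul 𝓕 x)) =
      scalar k A (PowerSeries.mapAlgHom (Bialgebra.counitAlgHom k A) x) := by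
  have h1 : convolve (sandwichAntipode k A) 𝓕⁻¹.val w.val = 1 := by
    rw [hw, ← convolve_sandwichAntipode_mul, 𝓕.inv_mul]
    exact convolve_sandwich_one rfl HopfAlgebra.antipode_one 1
  rw [mul'_tensorMap_id_twistAntipode, twistComul_apply, convolve_sandwichAntipode_mul, h1,
    convolve_sandwichAntipode_mul, convolve_sandwichAntipode_comul, ← mul_one (scalar k A _),
    convolve_sandwich_scalar_mul, ← hw, mul_assoc, w.mul_inv]

/-! ### The twisted Hopf structure -/

/-- The twisting of the standard Hopf structure on `A⟦t⟧` by a Drinfel'd twist `𝓕`, where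
`w = m(id ⊗ S₀)(𝓕)`. -/
def twistHopfStructure {𝓕 : ((A ⊗[k] A)⟦X⟧)ˣ} (h𝓕 : IsDrinfeldTwist 𝓕) {w : (A⟦X⟧)ˣ}
    (hw : w.val = convolve (sandwichAntipode k A) 𝓕.val 1) : HopfStructure k A where
  comul := twistComul 𝓕
  counit := PowerSeries.mapAlgHom (Bialgebra.counitAlgHom k A)
  antipode := twistAntipode w
  comul_scalar c := by
    have : PowerSeries.mapAlgHom (Bialgebra.comulAlgHom k A) (scalar k A c) =
        scalar k (A ⊗[k] A) c := by
      ext n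
      simp [scalar, PowerSeries.mapAlgHom_apply]
    rw [twistComul_apply, this, ← scalar_mul_comm, mul_assoc, 𝓕.mul_inv, mul_one]
  counit_scalar c := by
    ext n
    simp [scalar, PowerSeries.mapAlgHom_apply]
  antipode_scalar_mul c x := by
    refine (xAdditive_twistAntipode w).map_scalar_mul (fun c a => ?_) c x
    rw [twistAntipode_apply, twistAntipode_apply, mapLin_C, mapLin_C, map_smul, Algebra.smul_def,
      map_mul, ← mul_assoc, ← mul_assoc, ← mul_assoc]
    congr 2
    ext n
    simp [Algebra.commutes]
  coassoc := twistComul_coassoc h𝓕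
  counit_comul := counit_twistComul h𝓕
  comul_counit := twistComul_counit h𝓕
  antipode_left := twistAntipode_left h𝓕 hw
  antipode_right := twistAntipode_right hw

theorem isTwisting_twistHopfStructure {𝓕 : ((A ⊗[k] A)⟦X⟧)ˣ} (h𝓕 : IsDrinfeldTwist 𝓕)
    {w : (A⟦X⟧)ˣ} (hw : w.val = convolve (sandwichAntipode k A) 𝓕.val 1) :
    IsTwisting 𝓕 (twistHopfStructure h𝓕 hw) where
  comul_eq := twistComul_apply 𝓕
  counit_eq := rfl
  antipode_eq := ⟨w, by rw [hw, mapLin_eq_convolve_sandwichAntipode], twistAntipode_apply w⟩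

theorem constantCoeff_units_inv {R : Type*} [Ring R] {u : (R⟦X⟧)ˣ}
    (h : PowerSeries.constantCoeff u.val = 1) : PowerSeries.constantCoeff u⁻¹.val = 1 := by
  have := congrArg PowerSeries.constantCoeff u.mul_inv
  rwa [map_mul, h, one_mul, map_one] at this

variable (k A) in
/-- Reduction modulo `t`. -/
def reduction : (A⟦X⟧ ⧸ (Ideal.span {PowerSeries.X} : Ideal A⟦X⟧)) →ₐ[k] A :=
  Ideal.Quotient.liftₐ _ (AlgHom.mk (PowerSeries.constantCoeff (R := A)) (fun c => by
      rw [PowerSeries.algebraMap_apply]; simp))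
    (fun a ha => by
      obtain ⟨c, rfl⟩ := Ideal.mem_span_singleton'.mp ha
      simp)

theorem reduction_bijective : Function.Bijective (reduction k A) := by
  constructor
  · rw [injective_iff_map_eq_zero]
    intro q hq
    obtain ⟨x, rfl⟩ := Ideal.Quotient.mk_surjective q
    have hx : PowerSeries.constantCoeff x = 0 := hq
    rw [Ideal.Quotient.eq_zero_iff_mem]
    refine Ideal.mem_span_singleton'.mpr ⟨PowerSeries.mk fun n => PowerSeries.coeff (n + 1) x, ?_⟩
    conv_rhs => rw [x.eq_shift_mul_X_add_const, hx, map_zero, add_zero]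
  · intro a
    refine ⟨Ideal.Quotient.mk _ (PowerSeries.C a), ?_⟩
    change PowerSeries.constantCoeff (PowerSeries.C a) = a
    simp

theorem isDeformation_twistHopfStructure {𝓕 : ((A ⊗[k] A)⟦X⟧)ˣ} (h𝓕 : IsDrinfeldTwist 𝓕)
    {w : (A⟦X⟧)ˣ} (hw : w.val = convolve (sandwichAntipode k A) 𝓕.val 1)
    (h1 : PowerSeries.constantCoeff 𝓕.val = 1) (h2 : PowerSeries.constantCoeff w.val = 1) :
    IsDeformation (twistHopfStructure h𝓕 hw) where
  quotient_equiv := ⟨AlgEquiv.ofBijective (reduction k A) reduction_bijective, fun x => rfl⟩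
  comul_mod x := by
    change PowerSeries.constantCoeff (twistComul 𝓕 x) = _
    rw [twistComul_apply, map_mul, map_mul, h1, constantCoeff_units_inv h1, one_mul, mul_one,
      PowerSeries.mapAlgHom_apply, ← PowerSeries.coeff_zero_eq_constantCoeff_apply,
      PowerSeries.coeff_map]
    simp
  counit_mod x := by
    change PowerSeries.constantCoeff (PowerSeries.mapAlgHom (Bialgebra.counitAlgHom k A) x) = _
    rw [PowerSeries.mapAlgHom_apply, ← PowerSeries.coeff_zero_eq_constantCoeff_apply,
      PowerSeries.coeff_map]
    simp
  antipode_mod x := by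
    change PowerSeries.constantCoeff (twistAntipode w x) = _
    rw [twistAntipode_apply, map_mul, map_mul, h2, constantCoeff_units_inv h2, one_mul, mul_one,
      ← PowerSeries.coeff_zero_eq_constantCoeff_apply, coeff_mapLin]
    simp

end Twisting

/-! ### Functoriality of the binomial series -/

section Functoriality

variable {k A B : Type*} [Field k] [Ring A] [Ring B] [Algebra k A] [Algebra k B]

theorem mapAlgHom_binomialSeries (φ : A →ₐ[k] B) (a x : A) :
    PowerSeries.mapAlgHom φ (binomialSeries k a x) = binomialSeries k (φ a) (φ x) := by
  have hf : ∀ r, φ (falling a (0 : k) r) = falling (φ a) (0 : k) r := by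
    intro r
    induction r with
    | zero => exact map_one φ
    | succ r ih => rw [falling, falling, map_mul, ih, map_add, AlgHom.commutes]
  ext r
  rw [mapAlgHom_eq_mapLin, coeff_mapLin]
  simp [binomialSeries, hf]

theorem mapAlgHom_oneSubPow (φ : A →ₐ[k] B) (x : A) (c : k) :
    PowerSeries.mapAlgHom φ (oneSubPow x c) = oneSubPow (φ x) c := by
  rw [oneSubPow_eq, oneSubPow_eq, mapAlgHom_binomialSeries, AlgHom.commutes]

theorem binomialSeries_zero_right (a : A) : binomialSeries k a 0 = 1 := by
  ext r
  rcases r with _ | r <;> simp [binomialSeries, falling, PowerSeries.coeff_one]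

theorem binomialSeries_zero_left [CharZero k] (x : A) : binomialSeries k 0 x = 1 :=
  (eq_binomialSeries (Commute.zero_left x) (by simp) (by simp)).symm

theorem mapAlgHom_X (φ : A →ₐ[k] B) :
    PowerSeries.mapAlgHom φ (PowerSeries.X : A⟦X⟧) = PowerSeries.X := by
  rw [PowerSeries.mapAlgHom_apply, PowerSeries.map_X]

end Functoriality

/-! ### Primitive elements -/

section Primitive

variable {k A : Type*} [CommRing k] [Ring A] [HopfAlgebra k A]

variable (k) in
/-- An element `x` of a Hopf algebra is primitive if `Δ₀(x) = x ⊗ 1 + 1 ⊗ x`. -/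
def Primitive (x : A) : Prop := Coalgebra.comul (R := k) x = x ⊗ₜ[k] 1 + 1 ⊗ₜ[k] x

theorem Primitive.counit_eq_zero {x : A} (hx : Primitive k x) :
    Coalgebra.counit (R := k) x = 0 := by
  have h := Coalgebra.rTensor_counit_comul (R := k) x
  rw [hx, map_add, LinearMap.rTensor_tmul, LinearMap.rTensor_tmul, Bialgebra.counit_one,
    add_eq_right] at h
  have := congrArg (fun z => Coalgebra.counit (R := k) (TensorProduct.lid k A z)) h
  simpa using this

theorem Primitive.antipode_eq_neg {x : A} (hx : Primitive k x) :
    HopfAlgebra.antipode k x = -x := by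
  have h := HopfAlgebra.mul_antipode_rTensor_comul_apply (R := k) x
  rw [hx, hx.counit_eq_zero] at h
  simp only [map_add, LinearMap.rTensor_tmul, LinearMap.mul'_apply, mul_one,
    HopfAlgebra.antipode_one, one_mul, map_zero] at h
  exact eq_neg_of_add_eq_zero_left h

end Primitive

/-! ### The Jordanian twist of a pair of primitive elements -/

section Jordanian

variable {k A : Type*} [Field k] [Ring A] [HopfAlgebra k A] {h e : A}

variable (k) in
/-- The series `𝓕 = (1 - e t)^h`, as a unit. -/
def twistUnit (h e : A) : ((A ⊗[k] A)⟦X⟧)ˣ :=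
  (PowerSeries.isUnit_iff_constantCoeff (φ := twistSeries k h e).mpr (by
    rw [twistSeries_eq, constantCoeff_binomialSeries]; exact isUnit_one)).unit

theorem val_twistUnit (h e : A) : (twistUnit k h e).val = twistSeries k h e := rfl

variable (k) in
/-- The series `w = m(id ⊗ S₀)(𝓕) = ∑ᵣ (1 / r!) h^{[r]} eʳ tʳ`, as a unit. -/
def antipodeUnit (h e : A) : (A⟦X⟧)ˣ :=
  (PowerSeries.isUnit_iff_constantCoeff (φ := binomialSeries k h (-e)).mpr (by
    rw [constantCoeff_binomialSeries]; exact isUnit_one)).unit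

theorem val_antipodeUnit (h e : A) : (antipodeUnit k h e).val = binomialSeries k h (-e) := rfl

theorem val_antipodeUnit_eq (he : Primitive k e) : (antipodeUnit k h e).val =
    convolve (sandwichAntipode k A) (twistUnit k h e).val 1 := by
  have hS : ∀ r, HopfAlgebra.antipode k (e ^ r) = (-e) ^ r := by
    intro r
    induction r with
    | zero => simp
    | succ r ih => rw [pow_succ, HopfAlgebra.antipode_mul_antidistrib, ih, he.antipode_eq_neg,
      pow_succ']
  rw [← mapLin_eq_convolve_sandwichAntipode, val_antipodeUnit, val_twistUnit]
  ext r
  simp [coeff_mapLin, twistSeries, binomialSeries, hS]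

/-- `ad e` raises the weight for `ad h` by one. -/
theorem weight_commutator {y z : A} {c : k} (hhe : h * e = e * (h + 1))
    (hy : h * y = y * (h + algebraMap k A c)) (hz : e * y = y * e + z) :
    h * z = z * (h + algebraMap k A (c + 1)) := by
  have hz' : z = e * y - y * e := by rw [hz]; abel
  have hc := Algebra.commutes c e
  have h1 : h * (e * y) = e * y * (h + algebraMap k A c + 1) := by
    rw [← mul_assoc, hhe, mul_assoc, add_mul, hy]; noncomm_ring
  have h2 : h * (y * e) = y * e * (h + algebraMap k A c + 1) := by
    rw [← mul_assoc, hy, mul_assoc, add_mul, hhe, hc]; noncomm_ring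
  rw [map_add, map_one, ← add_assoc, hz', mul_sub, sub_mul, h1, h2]

variable [CharZero k]

theorem isDrinfeldTwist_twistUnit (hh : Primitive k h) (he : Primitive k e)
    (hhe : h * e = e * (h + 1)) : IsDrinfeldTwist (twistUnit k h e) where
  cocycle := by
    rw [val_twistUnit, twistSeries_eq]
    simp only [map_mul, mapAlgHom_binomialSeries]
    have key := binomialSeries_cocycle (k := k) (h₁ := h ⊗ₜ[k] ((1 : A) ⊗ₜ[k] (1 : A)))
      (h₂ := (1 : A) ⊗ₜ[k] (h ⊗ₜ[k] (1 : A))) (e₂ := (1 : A) ⊗ₜ[k] (e ⊗ₜ[k] (1 : A)))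
      (e₃ := (1 : A) ⊗ₜ[k] ((1 : A) ⊗ₜ[k] e)) (by simp [commute_iff_eq]) (by simp [commute_iff_eq])
      (by simp [commute_iff_eq]) (by simp [commute_iff_eq]) (by simp [commute_iff_eq])
      (by simp [Algebra.TensorProduct.one_def, ← TensorProduct.tmul_add, ← TensorProduct.add_tmul,
        hhe])
    have hh' : Coalgebra.comul (R := k) h = h ⊗ₜ[k] 1 + 1 ⊗ₜ[k] h := hh
    have he' : Coalgebra.comul (R := k) e = e ⊗ₜ[k] 1 + 1 ⊗ₜ[k] e := he
    simpa [hh', he', Algebra.TensorProduct.one_def, TensorProduct.tmul_add,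
      TensorProduct.add_tmul] using key
  counit_left := by
    rw [← counitLeft_toLinearMap, ← mapAlgHom_eq_mapLin, val_twistUnit, twistSeries_eq,
      mapAlgHom_binomialSeries]
    have : counitLeft k A (h ⊗ₜ[k] 1) = 0 := by simp [counitLeft, hh.counit_eq_zero]
    rw [this, binomialSeries_zero_left]
  counit_right := by
    rw [← counitRight_toLinearMap, ← mapAlgHom_eq_mapLin, val_twistUnit, twistSeries_eq,
      mapAlgHom_binomialSeries]
    have : counitRight k A (1 ⊗ₜ[k] e) = 0 := by simp [counitRight, he.counit_eq_zero]
    rw [this, binomialSeries_zero_right]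

/-- The coproduct twisted by `(1 - e t)^h` of a primitive element `y₀` of weight `c` such that
`ad e` takes `y₀` to `y₁`, `y₁` to `2 y₂`, and `y₂` to zero. -/
theorem twistComul_primitive {y₀ y₁ y₂ : A} {c : k}
    (hy : Primitive k y₀)
    (w0 : h * y₀ = y₀ * (h + algebraMap k A c))
    (h0 : e * y₀ = y₀ * e + y₁) (h1 : e * y₁ = y₁ * e + (y₂ + y₂)) (h2 : Commute e y₂) :
    twistComul (twistUnit k h e) (PowerSeries.C y₀) =
      tmul k 1 (PowerSeries.C y₀) + tmul k (PowerSeries.C y₀) (oneSubPow e c) -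
        tmul k (PowerSeries.C h) (oneSubPow e (-1 : k) * PowerSeries.C y₁ * PowerSeries.X) +
        tmul k (PowerSeries.C (rising h (0 : k) 2))
          (oneSubPow e (-2 : k) * PowerSeries.C y₂ * PowerSeries.X ^ 2) := by
  rw [twistComul_apply, Units.mul_inv_eq_iff_eq_mul, mapAlgHom_C, Bialgebra.comulAlgHom_apply, hy,
    val_twistUnit, twistSeries_eq]
  simp only [tmul_eq, map_mul, map_one, map_pow, mapAlgHom_C, mapAlgHom_oneSubPow, mapAlgHom_X,
    map_add, one_mul]
  have hc : Commute (h ⊗ₜ[k] (1 : A)) ((1 : A) ⊗ₜ[k] e) := by simp [commute_iff_eq]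
  have k1 := binomialSeries_mul_eigenvector (k := k) (c := c) (y := y₀ ⊗ₜ[k] (1 : A)) hc
    (by simp [w0, mul_add, TensorProduct.add_tmul, Algebra.TensorProduct.algebraMap_apply])
    (by simp [commute_iff_eq])
  have k2 := binomialSeries_mul_nilpotent (k := k) (y₀ := (1 : A) ⊗ₜ[k] y₀)
    (y₁ := (1 : A) ⊗ₜ[k] y₁) (y₂ := (1 : A) ⊗ₜ[k] y₂) hc (by simp [commute_iff_eq])
    (by simp [commute_iff_eq]) (by simp [commute_iff_eq])
    (by simp [h0, TensorProduct.tmul_add]) (by simp [h1, TensorProduct.tmul_add])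
    (by simp [commute_iff_eq, h2.eq])
  have hr : (Algebra.TensorProduct.includeLeft : A →ₐ[k] A ⊗[k] A) (rising h (0 : k) 2) =
      h ⊗ₜ[k] (1 : A) * (h ⊗ₜ[k] (1 : A) + 1) := by
    simp [rising, mul_add, TensorProduct.add_tmul, Algebra.TensorProduct.one_def]
  rw [mul_add, k1, k2, hr, oneSubPow_neg_two, oneSubPow_neg_one]
  simp only [Algebra.TensorProduct.includeLeft_apply, Algebra.TensorProduct.includeRight_apply]
  noncomm_ring

/-- The antipode twisted by `(1 - e t)^h` of a primitive element `y₀` of weight `c` such that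
`ad e` takes `y₀` to `y₁`, `y₁` to `2 y₂`, and `y₂` to zero. -/
theorem twistAntipode_primitive (hhe : h * e = e * (h + 1)) {y₀ y₁ y₂ : A} {c : k}
    (hy : Primitive k y₀)
    (w0 : h * y₀ = y₀ * (h + algebraMap k A c))
    (h0 : e * y₀ = y₀ * e + y₁) (h1 : e * y₁ = y₁ * e + (y₂ + y₂)) (h2 : Commute e y₂) :
    twistAntipode (k := k) (antipodeUnit k h e) (PowerSeries.C y₀) =
      -(oneSubPow e (-c) * (PowerSeries.C y₀ +
        PowerSeries.C y₁ * PowerSeries.C (falling h (1 : k) 1) * PowerSeries.X +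
        PowerSeries.C y₂ * PowerSeries.C (falling h (2 : k) 2) * PowerSeries.X ^ 2)) := by
  have := isAddTorsionFree_of_algebra k A
  have w1 := weight_commutator hhe w0 h0
  have w2 : h * y₂ = y₂ * (h + algebraMap k A c + 2) := by
    have h3 := weight_commutator hhe w1 h1
    rw [mul_add, add_mul, ← two_nsmul, ← two_nsmul] at h3
    have h4 := nsmul_right_injective two_ne_zero h3
    rw [h4, map_add, map_add, map_one, add_assoc (algebraMap k A c), one_add_one_eq_two,
      ← add_assoc]
  rw [map_add, map_one, ← add_assoc] at w1
  rw [twistAntipode_apply, Units.mul_inv_eq_iff_eq_mul, mapLin_C, hy.antipode_eq_neg,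
    val_antipodeUnit, map_neg, mul_neg, binomialSeries_neg_mul hhe w0 w1 w2 h0 h1 h2, neg_mul]

end Jordanian

end Formal

/-! ### The Schrödinger–Virasoro algebra -/

namespace UniversalEnvelopingAlgebra

section

attribute [local instance 100] LieRing.ofAssociativeRing

variable {k L : Type*} [CommRing k] [LieRing L] [LieAlgebra k L]

theorem ι_mul_ι (x y : L) : ι k x * ι k y = ι k y * ι k x + ι k ⁅x, y⁆ := by
  rw [LieHom.map_lie, LieRing.of_associative_ring_bracket]; abel

theorem ι_mul_ι_of_lie_eq_smul {x y : L} {c : k} (h : ⁅x, y⁆ = c • y) :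
    ι k x * ι k y = ι k y * (ι k x + algebraMap k _ c) := by
  rw [ι_mul_ι, h, map_smul, mul_add, ← Algebra.commutes, Algebra.smul_def]

theorem primitive_ι (x : L) : Formal.Primitive k (ι k x) := comul₀_ι k x

variable (k) in
/-- The linear map `u ↦ ad(u)(y)` given by the adjoint action of the enveloping algebra. -/
def adjointAt (y : L) : UniversalEnvelopingAlgebra k L →ₗ[k] L :=
  (LinearMap.applyₗ y).comp (lift k (LieAlgebra.ad k L)).toLinearMap

theorem adjointAt_ι (x y : L) : adjointAt k y (ι k x) = ⁅x, y⁆ := by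
  change lift k (LieAlgebra.ad k L) (ι k x) y = ⁅x, y⁆
  rw [lift_ι_apply, LieAlgebra.ad_apply]

end

end UniversalEnvelopingAlgebra

namespace SchrodingerVirasoro

section

variable {F : Type*} [Field F] [CharZero F]

theorem lie_L_L (m n : ℤ) : ⁅L F m, L F n⁆ = ((n : F) - m) • L F (m + n) :=
  bracket_basis F (.L m) (.L n)

theorem lie_L_M (m n : ℤ) : ⁅L F m, M F n⁆ = (n : F) • M F (m + n) :=
  bracket_basis F (.L m) (.M n)

theorem lie_L_Y (m j : ℤ) : ⁅L F m, Y F j⁆ = ((j : F) + 1 / 2 - m / 2) • Y F (m + j) :=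
  bracket_basis F (.L m) (.Y j)

theorem lie_Y_L (m j : ℤ) : ⁅Y F j, L F m⁆ = -(((j : F) + 1 / 2 - m / 2) • Y F (m + j)) :=
  bracket_basis F (.Y j) (.L m)

theorem lie_M_L (m n : ℤ) : ⁅M F n, L F m⁆ = -((n : F) • M F (m + n)) :=
  bracket_basis F (.M n) (.L m)

theorem lie_Y_Y (i j : ℤ) :
    ⁅Y F i, Y F j⁆ = (((j : F) + 1 / 2) - ((i : F) + 1 / 2)) • M F (i + j + 1) :=
  bracket_basis F (.Y i) (.Y j)

theorem lie_Y_M (j n : ℤ) : ⁅Y F j, M F n⁆ = 0 :=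
  bracket_basis F (.Y j) (.M n)

variable (F) in
/-- The linear form on the enveloping algebra which takes `u` to the coordinate of `ad(u)(L₀)` at a
basis vector. -/
def coordAt (i : SVIndex) : U F →ₗ[F] F :=
  (basis F).coord i ∘ₗ UniversalEnvelopingAlgebra.adjointAt F (L F 0)

theorem coordAt_Y_Y (j : ℤ) : coordAt F (.Y j) (UniversalEnvelopingAlgebra.ι F (Y F j)) =
    -((j : F) + 1 / 2) := by
  rw [coordAt, LinearMap.comp_apply, UniversalEnvelopingAlgebra.adjointAt_ι, lie_Y_L, zero_add, Y,
    map_neg, map_smul, Module.Basis.coord_apply, Module.Basis.repr_self, Finsupp.single_eq_same]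
  simp

theorem coordAt_M_Y (n j : ℤ) :
    coordAt F (.M n) (UniversalEnvelopingAlgebra.ι F (Y F j)) = 0 := by
  rw [coordAt, LinearMap.comp_apply, UniversalEnvelopingAlgebra.adjointAt_ι, lie_Y_L, zero_add, Y,
    map_neg, map_smul, Module.Basis.coord_apply, Module.Basis.repr_self,
    Finsupp.single_eq_of_ne (by simp), smul_zero, neg_zero]

theorem coordAt_M_M (n : ℤ) : coordAt F (.M n) (UniversalEnvelopingAlgebra.ι F (M F n)) =
    -(n : F) := by
  rw [coordAt, LinearMap.comp_apply, UniversalEnvelopingAlgebra.adjointAt_ι, lie_M_L, zero_add, M,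
    map_neg, map_smul, Module.Basis.coord_apply, Module.Basis.repr_self, Finsupp.single_eq_same]
  simp

end

end SchrodingerVirasoro

open Formal SchrodingerVirasoro UniversalEnvelopingAlgebra in
/-- Quantization of the Schrödinger–Virasoro Lie algebra by the Drinfel'd twist attached to
`h = (2 / n₀) L₀` and `e = Y_{n₀/2}`, where `n₀ = 2 j₀ + 1` is odd. Below, `Lt n`, `Mt n` and
`Yt j` are the elements `Lₙ`, `Mₙ` and `Y_{j + 1/2}` of `U⟦t⟧`, so that `Y_{n + n₀/2}` is
`Yt (n + j₀)`, and `M_{p + n₀/2}` is `Mt (j + j₀ + 1)` for `p = j + 1/2`. -/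
theorem theorem1p2 (F : Type*) [Field F] [CharZero F] (n₀ j₀ : ℤ) (hn₀ : n₀ = 2 * j₀ + 1)
    (hL eL : SchrodingerVirasoro F)
    (hhL : hL = (2 / (n₀ : F)) • SchrodingerVirasoro.L F 0)
    (heL : eL = SchrodingerVirasoro.Y F j₀)
    (h e : SchrodingerVirasoro.U F)
    (hh : h = UniversalEnvelopingAlgebra.ι F hL)
    (he : e = UniversalEnvelopingAlgebra.ι F eL) :
    ⁅hL, eL⁆ = eL ∧
    ∃ 𝓕 : ((SchrodingerVirasoro.U F ⊗[F] SchrodingerVirasoro.U F)⟦X⟧)ˣ,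
      𝓕.val = Formal.twistSeries F h e ∧
      Formal.IsDrinfeldTwist (k := F) 𝓕 ∧
    ∃ H : Formal.HopfStructure F (SchrodingerVirasoro.U F),
      Formal.IsTwisting 𝓕 H ∧
      Formal.IsDeformation H ∧
      (∃ x y : (SchrodingerVirasoro.U F)⟦X⟧, x * y ≠ y * x) ∧
      H.Noncocommutative ∧
      H.counit = PowerSeries.mapAlgHom (Bialgebra.counitAlgHom F (SchrodingerVirasoro.U F)) ∧
      (∀ n : ℤ, H.comul (SchrodingerVirasoro.Lt F n) =
        Formal.tmul F 1 (SchrodingerVirasoro.Lt F n) +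
        Formal.tmul F (SchrodingerVirasoro.Lt F n) (Formal.oneSubPow e (2 * (n : F) / n₀)) +
        (((n₀ : F) - n) / 2) • Formal.tmul F (PowerSeries.C h)
          (Formal.oneSubPow e (-1 : F) * SchrodingerVirasoro.Yt F (n + j₀) * PowerSeries.X) +
        ((n : F) * (n - n₀) / 4) • Formal.tmul F (PowerSeries.C (Formal.rising h (0 : F) 2))
          (Formal.oneSubPow e (-2 : F) * SchrodingerVirasoro.Mt F (n + n₀) *
            PowerSeries.X ^ 2)) ∧
      (∀ k : ℤ, H.comul (SchrodingerVirasoro.Mt F k) =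
        Formal.tmul F 1 (SchrodingerVirasoro.Mt F k) +
        Formal.tmul F (SchrodingerVirasoro.Mt F k) (Formal.oneSubPow e (2 * (k : F) / n₀))) ∧
      (∀ (j : ℤ) (p : F), p = (j : F) + 1 / 2 → H.comul (SchrodingerVirasoro.Yt F j) =
        Formal.tmul F 1 (SchrodingerVirasoro.Yt F j) +
        Formal.tmul F (SchrodingerVirasoro.Yt F j) (Formal.oneSubPow e (2 * p / n₀)) -
        (p - (n₀ : F) / 2) • Formal.tmul F (PowerSeries.C h)
          (Formal.oneSubPow e (-1 : F) * SchrodingerVirasoro.Mt F (j + j₀ + 1) *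
            PowerSeries.X)) ∧
      (∀ n : ℤ, H.antipode (SchrodingerVirasoro.Lt F n) =
        -(Formal.oneSubPow e (-(2 * (n : F) / n₀)) *
          (SchrodingerVirasoro.Lt F n +
            (((n : F) - n₀) / 2) • (SchrodingerVirasoro.Yt F (n + j₀) *
              PowerSeries.C (Formal.falling h (1 : F) 1) * PowerSeries.X) +
            ((n : F) * (n - n₀) / 4) • (SchrodingerVirasoro.Mt F (n + n₀) *
              PowerSeries.C (Formal.falling h (2 : F) 2) * PowerSeries.X ^ 2)))) ∧
      (∀ (j : ℤ) (p : F), p = (j : F) + 1 / 2 → H.antipode (SchrodingerVirasoro.Yt F j) =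
        -(Formal.oneSubPow e (-(2 * p / n₀)) *
          (SchrodingerVirasoro.Yt F j +
            (p - (n₀ : F) / 2) • (SchrodingerVirasoro.Mt F (j + j₀ + 1) *
              PowerSeries.C (Formal.falling h (1 : F) 1) * PowerSeries.X)))) ∧
      (∀ k : ℤ, H.antipode (SchrodingerVirasoro.Mt F k) =
        -(Formal.oneSubPow e (-(2 * (k : F) / n₀)) * SchrodingerVirasoro.Mt F k)) := by
  have hn₀F : (n₀ : F) ≠ 0 := by
    have : n₀ ≠ 0 := by omega
    exact_mod_cast this
  have hj₀F : (j₀ : F) = (n₀ - 1) / 2 := by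
    rw [hn₀]; push_cast; ring
  have weight_L : ∀ n : ℤ, ⁅hL, L F n⁆ = (2 * (n : F) / n₀) • L F n := fun n => by
    rw [hhL, smul_lie, lie_L_L, smul_smul, zero_add]
    congr 1
    push_cast
    ring
  have weight_M : ∀ n : ℤ, ⁅hL, M F n⁆ = (2 * (n : F) / n₀) • M F n := fun n => by
    rw [hhL, smul_lie, lie_L_M, smul_smul, zero_add]
    congr 1
    ring
  have weight_Y : ∀ (j : ℤ) (p : F), p = (j : F) + 1 / 2 →
      ⁅hL, Y F j⁆ = (2 * p / n₀) • Y F j := fun j p hp => by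
    rw [hhL, smul_lie, lie_L_Y, smul_smul, zero_add, hp]
    congr 1
    push_cast
    ring
  have lie_e_L : ∀ n : ℤ, ⁅eL, L F n⁆ = (((n : F) - n₀) / 2) • Y F (n + j₀) := fun n => by
    rw [heL, lie_Y_L, hj₀F, ← neg_smul]
    congr 1
    ring
  have lie_e_Y : ∀ (j : ℤ) (p : F), p = (j : F) + 1 / 2 →
      ⁅eL, Y F j⁆ = (p - (n₀ : F) / 2) • M F (j + j₀ + 1) := fun j p hp => by
    rw [heL, lie_Y_Y, hj₀F, hp, add_comm j₀ j]
    congr 1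
    ring
  have lie_e_M : ∀ n : ℤ, ⁅eL, M F n⁆ = 0 := fun n => by rw [heL, lie_Y_M]
  have lie_h_e : ⁅hL, eL⁆ = eL := by
    rw [heL, weight_Y j₀ (n₀ / 2) (by rw [hj₀F]; ring)]
    conv_rhs => rw [← one_smul F (Y F j₀)]
    congr 1
    field_simp
  refine ⟨lie_h_e, ?_⟩
  have hhe : h * e = e * (h + 1) := by
    rw [hh, he, ι_mul_ι, lie_h_e, mul_add, mul_one]
  have hprim : Primitive F h := hh ▸ primitive_ι hL
  have eprim : Primitive F e := he ▸ primitive_ι eL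
  have twist := isDrinfeldTwist_twistUnit hprim eprim hhe
  have hw := val_antipodeUnit_eq (h := h) eprim
  have e_mul : ∀ x y, ⁅eL, x⁆ = y → e * ι F x = ι F x * e + ι F y := fun x y hxy => by
    rw [he, ι_mul_ι, hxy]
  have h_mul : ∀ (x : SchrodingerVirasoro F) (c : F), ⁅hL, x⁆ = c • x →
      h * ι F x = ι F x * (h + algebraMap F _ c) := fun x c hx => by
    rw [hh, ι_mul_ι_of_lie_eq_smul hx]
  have e_mul_M : ∀ n : ℤ, Commute e (ι F (M F n)) := fun n => by
    rw [commute_iff_eq, e_mul _ _ (lie_e_M n), map_zero, add_zero]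
  -- The hypotheses on `L n`, with `y₁` a multiple of `Y` and `y₂` a multiple of `M`.
  have hL1 : ∀ n : ℤ, e * ι F (L F n) =
      ι F (L F n) * e + (((n : F) - n₀) / 2) • ι F (Y F (n + j₀)) := fun n => by
    rw [e_mul _ _ (lie_e_L n), map_smul]
  have hL2 : ∀ n : ℤ, e * (((n : F) - n₀) / 2) • ι F (Y F (n + j₀)) =
      (((n : F) - n₀) / 2) • ι F (Y F (n + j₀)) * e +
        (((n : F) * (n - n₀) / 4) • ι F (M F (n + n₀)) +
          ((n : F) * (n - n₀) / 4) • ι F (M F (n + n₀))) := fun n => by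
    rw [mul_smul_comm, e_mul _ _ (lie_e_Y (n + j₀) _ rfl), map_smul, smul_add, smul_smul,
      smul_mul_assoc, ← add_smul]
    have hi : n + j₀ + j₀ + 1 = n + n₀ := by omega
    rw [hi]
    congr 2
    push_cast
    rw [hj₀F]
    ring
  have hY1 : ∀ (j : ℤ) (p : F), p = (j : F) + 1 / 2 → e * ι F (Y F j) =
      ι F (Y F j) * e + (p - (n₀ : F) / 2) • ι F (M F (j + j₀ + 1)) := fun j p hp => by
    rw [e_mul _ _ (lie_e_Y j p hp), map_smul]
  have hY2 : ∀ (j : ℤ) (c : F), e * c • ι F (M F j) = c • ι F (M F j) * e + (0 + 0) :=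
    fun j c => by rw [((e_mul_M j).smul_right c).eq, add_zero, add_zero]
  have C_smul : ∀ (c : F) (x : U F), PowerSeries.C (c • x) = c • PowerSeries.C x := fun c x => by
    ext n
    rw [PowerSeries.coeff_smul, PowerSeries.coeff_C, PowerSeries.coeff_C]
    split_ifs <;> simp
  have comul_M : ∀ k : ℤ, twistComul (twistUnit F h e) (Mt F k) =
      tmul F 1 (Mt F k) + tmul F (Mt F k) (oneSubPow e (2 * (k : F) / n₀)) := fun k => by
    rw [Mt, twistComul_primitive (y₁ := 0) (y₂ := 0) (primitive_ι _) (h_mul _ _ (weight_M k))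
      (by rw [(e_mul_M k).eq, add_zero]) (by simp) (Commute.zero_right e)]
    simp
  refine ⟨twistUnit F h e, val_twistUnit h e, twist, twistHopfStructure twist hw,
    isTwisting_twistHopfStructure twist hw,
    isDeformation_twistHopfStructure twist hw
      (by rw [val_twistUnit, twistSeries_eq, constantCoeff_binomialSeries])
      (by rw [val_antipodeUnit, constantCoeff_binomialSeries]), ?_, ?_, rfl, ?_, comul_M, ?_,
    ?_, ?_, ?_⟩
  · refine ⟨PowerSeries.C h, PowerSeries.C e, fun hc => ?_⟩
    rw [C_mul_C, C_mul_C, hhe, mul_add, mul_one, map_add, add_eq_left,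
      ← map_zero (PowerSeries.C (R := U F)), PowerSeries.C_injective.eq_iff] at hc
    have := congrArg (coordAt F (.Y j₀)) hc
    rw [he, heL, coordAt_Y_Y, hj₀F, map_zero, neg_eq_zero] at this
    apply hn₀F
    linear_combination 2 * this
  · refine ⟨Mt F 1, fun hc => ?_⟩
    change Formal.flip F (U F) (twistComul (twistUnit F h e) (Mt F 1)) =
      twistComul (twistUnit F h e) (Mt F 1) at hc
    -- The coefficient of `t` in the coproduct of `M 1` is a nonzero multiple of `M 1 ⊗ e`.
    have h1 : PowerSeries.coeff 1 (twistComul (twistUnit F h e) (Mt F 1)) =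
        (-(2 / n₀) : F) • (ι F (M F 1) ⊗ₜ[F] e) := by
      rw [comul_M]
      simp [Finset.Nat.antidiagonal_succ, coeff_tmul, Mt, oneSubPow, PowerSeries.coeff_one,
        -ι_apply, PowerSeries.coeff_C]
    have h2 := congrArg (PowerSeries.coeff 1) hc
    rw [Formal.flip, coeff_mapLin, h1] at h2
    have h3 := congrArg (fun z => LinearMap.mul' F F
      (TensorProduct.map (coordAt F (.M 1)) (coordAt F (.Y j₀)) z)) h2
    simp only [LinearEquiv.coe_coe, map_smul, TensorProduct.comm_tmul,
      TensorProduct.map_tmul, LinearMap.mul'_apply, he, heL, coordAt_Y_Y, coordAt_M_Y,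
      coordAt_M_M, zero_mul, smul_eq_mul, hj₀F] at h3
    field_simp at h3
    simp at h3
    omega
  · intro n
    change twistComul (twistUnit F h e) (Lt F n) = _
    rw [Lt, twistComul_primitive (primitive_ι _) (h_mul _ _ (weight_L n)) (hL1 n) (hL2 n)
      ((e_mul_M _).smul_right _)]
    simp only [C_smul, mul_smul_comm, smul_mul_assoc, map_smul]
    rw [← Yt, ← Mt, sub_eq_add_neg, ← neg_smul]
    congr 3
    ring
  · intro j p hp
    change twistComul (twistUnit F h e) (Yt F j) = _
    rw [Yt, twistComul_primitive (primitive_ι _) (h_mul _ _ (weight_Y j p hp)) (hY1 j p hp)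
      (hY2 _ _) (Commute.zero_right e)]
    simp [C_smul, Mt]
  · intro n
    change twistAntipode (antipodeUnit F h e) (Lt F n) = _
    rw [Lt, twistAntipode_primitive hhe (primitive_ι _) (h_mul _ _ (weight_L n)) (hL1 n) (hL2 n)
      ((e_mul_M _).smul_right _)]
    simp only [C_smul, smul_mul_assoc]
    rfl
  · intro j p hp
    change twistAntipode (antipodeUnit F h e) (Yt F j) = _
    rw [Yt, twistAntipode_primitive hhe (primitive_ι _) (h_mul _ _ (weight_Y j p hp)) (hY1 j p hp)
      (hY2 _ _) (Commute.zero_right e)]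
    simp [C_smul, Mt]
  · intro k
    change twistAntipode (antipodeUnit F h e) (Mt F k) = _
    rw [Mt, twistAntipode_primitive (y₁ := 0) (y₂ := 0) hhe (primitive_ι _) (h_mul _ _ (weight_M k))
      (by rw [(e_mul_M k).eq, add_zero]) (by simp) (Commute.zero_right e)]
    simp

end
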